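/- **Setting.** All information quantities are in nats. Let $\sigma\ge 0$, $q\in[0,1]$, and let $f:[0,1]\to\mathbb R$ be continuous, such that $m\mapsto \mathcal H_2(m)+f(m)$ has a unique maximizer $m_a$ on $[0,1]$, where $\mathcal H_2$ is the binary entropy function. For each dimension $n$ consider the random channel $$\mathbf Y=\mathbf A\mathbf H\mathbf X+\mathbf W,\qquad X_i=S_iU_i,$$ with $\mathbf S,\mathbf U,\mathbf A,\mathbf H,\mathbf W$ independent, where: $\mathbf S\in\{0,1\}^n$ has law $P(\mathbf s)=C_n\exp\{n f(m_s)\}$, $m_s=\frac1n\sum_i s_i$; $\mathbf H$ is an $n\times n$ matrix with i.i.d. entries of mean $0$ and variance $1/n$ (of an arbitrary law, which may depend on $n$); $\mathbf W$ has i.i.d. $N(0,1)$ entries; $\mathbf A$ is diagonal with $0/1$ entries, either i.i.d. with $P(A_{ii}=1)=q$, or deterministic with $k$ ones, $k/n\to q$. When $\mathbf U$ is taken i.i.d. $N(0,\sigma^2)$, define $I(\mathbf X;\mathbf Y|\mathbf A,\mathbf H)$ and $I(\mathbf U;\mathbf Y|\mathbf A,\mathbf H)$, and let $$\mathcal I_1=\limsup_{n\to\infty}\frac1n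 I(\mathbf X;\mathbf Y|\mathbf A,\mathbf H).$$ **Coding.** The information is carried by $\mathbf U$. The pattern $\mathbf S$ is known neither to the transmitter nor to the receiver; $(\mathbf A,\mathbf H)$ is known to the receiver only. Thus the channel of dimension $n$ has input $\mathbf u\in\mathbb R^n$ and output $(\mathbf Y,\mathbf A,\mathbf H)$, and it is used $N$ times, with independent realizations. A code consists of $M$ codewords $(\mathbf u_1,\dots,\mathbf u_N)\in(\mathbb R^n)^N$, each with $\sum_t\|\mathbf u_t\|^2\le Nn\sigma^2$, and of a measurable decoder. Reliable communication at rate $R'$ is possible in dimension $n$ if for every $\varepsilon>0$ and all sufficiently large $N$ there is a code with $M\ge e^{NnR'}$ and maximal error probability at most $\varepsilon$. A rate $R$ is achievable if for every $R'<R$ reliable communication at rate $R'$ is possible in infinitely many dimensions $n$. **Theorem (unknown sparsity pattern).** For every $n$, $$I(\mathbf U;\mathbf Y|\mathbf A,\mathbf H)\ \ge\ I(\mathbf X;\mathbf Y|\mathbf A,\mathbf H)-H(\mathbf S).$$ Moreover $\mathcal I_1<\infty$, and the rate $$R=\mathcal I_1-\mathcal H_2(m_a)$$ is achievable. If the limit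 superior defining $\mathcal I_1$ is a limit, then for every $R'<R$ reliable communication at rate $R'$ is possible in all sufficiently large dimensions $n$. -/

import Mathlib

open MeasureTheory ProbabilityTheory Filter Topology
open scoped ENNReal NNReal

noncomputable section

namespace SparseCoding

/-! ### Information measures (in nats) -/

/-- The conditional mutual information `I(X; Y | Z)`: the Kullback-Leibler divergence of the joint
law `P_{Z,X,Y}` from `P_Z ⊗ (P_{X|Z} × P_{Y|Z})`. -/
def condMutualInfo {Ω 𝓧 𝓨 𝓩 : Type*} [MeasurableSpace Ω]
    [MeasurableSpace 𝓧] [StandardBorelSpace 𝓧] [Nonempty 𝓧]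
    [MeasurableSpace 𝓨] [StandardBorelSpace 𝓨] [Nonempty 𝓨] [MeasurableSpace 𝓩]
    (X : Ω → 𝓧) (Y : Ω → 𝓨) (Z : Ω → 𝓩) (μ : Measure Ω) [IsFiniteMeasure μ] : ℝ≥0∞ :=
  InformationTheory.klDiv (μ.map fun ω => (Z ω, X ω, Y ω))
    ((μ.map Z) ⊗ₘ (condDistrib X Z μ ×ₖ condDistrib Y Z μ))

/-- The Shannon entropy of a probability mass function on a finite type. -/
def entropy {α : Type*} [Fintype α] (p : PMF α) : ℝ :=
  ∑ a, Real.negMulLog (p a).toReal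

/-! ### The pattern sequence -/

/-- The `0/1` value of a bit. -/
def bit (b : Bool) : ℝ := if b then 1 else 0

/-- The magnetization `m_s = (1/n) ∑ i, s_i`. -/
def magnetization {n : ℕ} (s : Fin n → Bool) : ℝ := (∑ i, bit (s i)) / n

/-- The unnormalized weight `exp (n f(m_s))` of a pattern. -/
def patternWeight (f : ℝ → ℝ) {n : ℕ} (s : Fin n → Bool) : ℝ :=
  Real.exp (n * f (magnetization s))

/-- The normalization constant `C_n`. -/
def patternConst (f : ℝ → ℝ) (n : ℕ) : ℝ := (∑ s : Fin n → Bool, patternWeight f s)⁻¹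

theorem sum_patternWeight_pos (f : ℝ → ℝ) (n : ℕ) :
    0 < ∑ s : Fin n → Bool, patternWeight f s :=
  Finset.sum_pos (fun _ _ => Real.exp_pos _) Finset.univ_nonempty

/-- The pattern distribution `P(s) = C_n exp (n f(m_s))` on `{0,1}ⁿ`. -/
def patternPMF (f : ℝ → ℝ) (n : ℕ) : PMF (Fin n → Bool) :=
  PMF.ofFintype (fun s => ENNReal.ofReal (patternConst f n * patternWeight f s)) (by
    have h := sum_patternWeight_pos f n
    rw [← ENNReal.ofReal_sum_of_nonneg, ← Finset.mul_sum, patternConst, inv_mul_cancel₀ h.ne',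
      ENNReal.ofReal_one]
    exact fun s _ => mul_nonneg (inv_nonneg.mpr h.le) (Real.exp_pos _).le)

/-! ### The observation model `Y = A H X + W`, `X = S ⊙ U` -/

/-- The channel states `(S, A, H, W)` of the channel of dimension `n`: pattern, sampling pattern
(the diagonal of `A`), the matrix `H` and the noise. -/
abbrev State (n : ℕ) : Type :=
  (Fin n → Bool) × (Fin n → Bool) × (Fin n → Fin n → ℝ) × (Fin n → ℝ)

/-- What the receiver sees: `(Y, A, H)`. -/
abbrev Output (n : ℕ) : Type := (Fin n → ℝ) × (Fin n → Bool) × (Fin n → Fin n → ℝ)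

/-- The law of `(S, A, H, W)`: independent components, `S` with the pattern distribution, `A` with
law `α`, `H` with i.i.d. entries of law `ν`, `W` with i.i.d. standard Gaussian entries. -/
def stateLaw {n : ℕ} (f : ℝ → ℝ) (α : Measure (Fin n → Bool)) (ν : Measure ℝ) :
    Measure (State n) :=
  (patternPMF f n).toMeasure.prod
    (α.prod ((Measure.pi fun _ => Measure.pi fun _ => ν).prod
      (Measure.pi fun _ => gaussianReal 0 1)))

instance {n : ℕ} (f : ℝ → ℝ) (α : Measure (Fin n → Bool)) (ν : Measure ℝ)
    [IsProbabilityMeasure α] [IsProbabilityMeasure ν] :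
    IsProbabilityMeasure (stateLaw f α ν) := by
  unfold stateLaw; infer_instance

/-- The sparse vector `X = S ⊙ U`. -/
def sparseVector {n : ℕ} (s : Fin n → Bool) (u : Fin n → ℝ) : Fin n → ℝ :=
  fun i => bit (s i) * u i

/-- `Y = A H (S ⊙ U) + W`. -/
def received {n : ℕ} (u : Fin n → ℝ) (z : State n) : Fin n → ℝ :=
  (Matrix.diagonal (fun i => bit (z.2.1 i)) * Matrix.of z.2.2.1).mulVec (sparseVector z.1 u)
    + z.2.2.2

/-- The law of `(U, (S, A, H, W))` when `U` has i.i.d. `N(0, σ²)` entries, independent of the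
channel state. -/
def modelLaw {n : ℕ} (σ : ℝ≥0) (f : ℝ → ℝ) (α : Measure (Fin n → Bool)) (ν : Measure ℝ) :
    Measure ((Fin n → ℝ) × State n) :=
  (Measure.pi fun _ => gaussianReal 0 (σ ^ 2)).prod (stateLaw f α ν)

instance {n : ℕ} (σ : ℝ≥0) (f : ℝ → ℝ) (α : Measure (Fin n → Bool)) (ν : Measure ℝ)
    [IsProbabilityMeasure α] [IsProbabilityMeasure ν] :
    IsProbabilityMeasure (modelLaw σ f α ν) := by
  unfold modelLaw; infer_instance

/-- `I(X; Y | A, H)`. -/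
def infoX {n : ℕ} (σ : ℝ≥0) (f : ℝ → ℝ) (α : Measure (Fin n → Bool)) (ν : Measure ℝ)
    [IsProbabilityMeasure α] [IsProbabilityMeasure ν] : ℝ≥0∞ :=
  condMutualInfo (fun ω : (Fin n → ℝ) × State n => sparseVector ω.2.1 ω.1)
    (fun ω => received ω.1 ω.2) (fun ω => (ω.2.2.1, ω.2.2.2.1)) (modelLaw σ f α ν)

/-- `I(U; Y | A, H)`. -/
def infoU {n : ℕ} (σ : ℝ≥0) (f : ℝ → ℝ) (α : Measure (Fin n → Bool)) (ν : Measure ℝ)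
    [IsProbabilityMeasure α] [IsProbabilityMeasure ν] : ℝ≥0∞ :=
  condMutualInfo (fun ω : (Fin n → ℝ) × State n => ω.1)
    (fun ω => received ω.1 ω.2) (fun ω => (ω.2.2.1, ω.2.2.2.1)) (modelLaw σ f α ν)

/-- The mutual information rate `𝓘₁ = limsup_n I(X; Y | A, H) / n`, in nats. -/
def rateI1 (σ : ℝ≥0) (f : ℝ → ℝ) (α : (n : ℕ) → Measure (Fin n → Bool)) (ν : ℕ → Measure ℝ)
    [∀ n, IsProbabilityMeasure (α n)] [∀ n, IsProbabilityMeasure (ν n)] : ℝ≥0∞ :=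
  limsup (fun n : ℕ => infoX σ f (α n) (ν n) / (n : ℝ≥0∞)) atTop

/-- `A` has sampling rate `q`: either its diagonal entries are i.i.d. with `P(A_ii = 1) = q`, or
`A` is a given matrix (for each `n`) whose number `k` of ones satisfies `k / n → q`. -/
def HasSamplingRate (q : unitInterval) (α : (n : ℕ) → Measure (Fin n → Bool)) : Prop :=
  (∀ n, α n = Measure.pi fun _ => bernoulliMeasure true false q) ∨
  ∃ a : (n : ℕ) → Fin n → Bool, (∀ n, α n = Measure.dirac (a n)) ∧
    Tendsto (fun n => magnetization (a n)) atTop (𝓝 (q : ℝ))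

/-! ### Codes and achievable rates -/

/-- The channel from `U` to `(Y, A, H)`: the law of the output for the input `u`. The pattern `S`
is drawn by the channel and is not part of the output. -/
def channel {n : ℕ} (f : ℝ → ℝ) (α : Measure (Fin n → Bool)) (ν : Measure ℝ) (u : Fin n → ℝ) :
    Measure (Output n) :=
  (stateLaw f α ν).map fun z => (received u z, z.2.1, z.2.2.1)

/-- A code with `M` messages for `N` uses of the channel of dimension `n`, with average power at
most `σ²` per coordinate in every codeword. The encoder sees the message only; the decoder sees
the `N` outputs `(Y, A, H)` only. -/
structure Code (n N M : ℕ) (σ : ℝ≥0) where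
  encoder : Fin M → Fin N → Fin n → ℝ
  decoder : (Fin N → Output n) → Fin M
  power_le : ∀ m, ∑ t, ∑ i, encoder m t i ^ 2 ≤ (N : ℝ) * n * (σ : ℝ) ^ 2
  measurable_decoder : Measurable decoder

/-- The probability that message `m` is decoded wrongly over `N` independent channel uses. -/
def Code.errorProb {n N M : ℕ} {σ : ℝ≥0} (c : Code n N M σ) (f : ℝ → ℝ)
    (α : Measure (Fin n → Bool)) (ν : Measure ℝ) (m : Fin M) : ℝ≥0∞ :=
  (Measure.pi fun t => channel f α ν (c.encoder m t)) {o | c.decoder o ≠ m}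

/-- Reliable communication at `R` nats per coordinate over the channel of dimension `n`: for every
`ε > 0` and all large `N` there is a code for `N` channel uses (hence `N n` coordinates) with at
least `exp (N n R)` codewords and maximal error probability at most `ε`. -/
def ReliableAt (n : ℕ) (σ : ℝ≥0) (f : ℝ → ℝ) (α : Measure (Fin n → Bool)) (ν : Measure ℝ)
    (R : ℝ) : Prop :=
  ∀ ε : ℝ≥0∞, 0 < ε → ∀ᶠ N : ℕ in atTop, ∃ (M : ℕ) (c : Code n N M σ),
    Real.exp ((N : ℝ) * n * R) ≤ M ∧ ∀ m, c.errorProb f α ν m ≤ ε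

/-- `R` is an achievable rate for the family of channels: every smaller rate admits reliable
communication in arbitrarily large dimensions `n`. -/
def IsAchievableRate (σ : ℝ≥0) (f : ℝ → ℝ) (α : (n : ℕ) → Measure (Fin n → Bool))
    (ν : ℕ → Measure ℝ) (R : ℝ) : Prop :=
  ∀ R' < R, ∃ᶠ n in atTop, ReliableAt n σ f (α n) (ν n) R'

end SparseCoding

end

/-! The argument runs on information densities. Given `(A, H)` and `X = x`, the output is standard
Gaussian noise translated by `A H x`, so its density relative to the standard Gaussian law is
explicit, positive and at most `exp (‖y‖² / 2)`. Given `U = u`, the density is the average over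
patterns `s`, with weights `P(s)`, of the densities for `x = s ⊙ u`. This average is at least any
one of its weighted terms, and both descriptions induce the same output density. Hence the
information density of `X` exceeds that of `U` by at most `-log P(s)` (`infoDensity_densityX_le`),
and expectation gives `I(X; Y | A, H) ≤ I(U; Y | A, H) + H(S)`. The exponent `‖y‖² / 2` has mean at
most `n (σ² + 1)`, which yields integrability and the finiteness of `𝓘₁`.

The entropy of `S` is controlled by two uses of Gibbs' inequality. A Bernoulli trial law of
parameter `m_a` bounds the log partition function from below; a method-of-types bound says that
`H(S)` is at most `n` times the mean of `H₂(m_s)`, up to `log (n + 1)`. Together they force the mean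
of `H₂ + f` at `m_s` towards its maximum, and uniqueness of the maximizer with compactness turns
this into `H(S) ≤ n (H₂(m_a) + ε)` for large `n`.

For coding, `n` is fixed and the channel is memoryless in the `N` uses. Feinstein's maximal code is
built by thresholding the summed information density under Gaussian inputs, with codewords confined
to the power constraint (`eventually_exists_code`). The mean power of the input is exactly the
allowed power, so by the central limit theorem the constraint keeps a probability bounded away from
zero; this costs a constant factor and no rate. -/

noncomputable section

/-! ### Entropy rate of the pattern sequence -/

namespace SparseCoding

/-- The number of ones of a pattern. -/
def ones {n : ℕ} (s : Fin n → Bool) : ℕ := (Finset.univ.filter fun i => s i = true).card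

theorem ones_le {n : ℕ} (s : Fin n → Bool) : ones s ≤ n :=
  (Finset.card_filter_le _ _).trans (by simp)

theorem magnetization_eq {n : ℕ} (s : Fin n → Bool) : magnetization s = (ones s : ℝ) / n := by
  simp [magnetization, ones, bit]

theorem magnetization_mem {n : ℕ} (s : Fin n → Bool) : magnetization s ∈ Set.Icc (0 : ℝ) 1 := by
  rw [magnetization_eq]
  refine ⟨by positivity, div_le_one_of_le₀ ?_ (by positivity)⟩
  exact_mod_cast ones_le s

theorem sum_comp_ones (n : ℕ) (F : ℕ → ℝ) :
    ∑ s : Fin n → Bool, F (ones s) = ∑ k ∈ Finset.range (n + 1), (n.choose k : ℝ) * F k := by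
  have h := Finset.sum_powerset_apply_card F (x := (Finset.univ : Finset (Fin n)))
  simp only [Finset.card_univ, Fintype.card_fin, nsmul_eq_mul] at h
  rw [← h]
  refine Finset.sum_nbij' (fun s => Finset.univ.filter fun i => s i = true)
    (fun T i => decide (i ∈ T)) ?_ ?_ ?_ ?_ ?_
  · simp
  · simp
  · intro s _; ext i; simp
  · intro T _; ext i; simp
  · intro s _; rfl

/-- The i.i.d. Bernoulli weight of a pattern. -/
def bernoulliWeight (p : ℝ) {n : ℕ} (s : Fin n → Bool) : ℝ :=
  p ^ ones s * (1 - p) ^ (n - ones s)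

theorem bernoulliWeight_nonneg {p : ℝ} (hp : p ∈ Set.Icc (0 : ℝ) 1) {n : ℕ} (s : Fin n → Bool) :
    0 ≤ bernoulliWeight p s :=
  mul_nonneg (pow_nonneg hp.1 _) (pow_nonneg (by linarith [hp.2]) _)

theorem sum_bernoulliWeight (p : ℝ) (n : ℕ) :
    ∑ s : Fin n → Bool, bernoulliWeight p s = 1 := by
  have h := sum_comp_ones n fun k => p ^ k * (1 - p) ^ (n - k)
  have h2 := add_pow p (1 - p) n
  rw [add_sub_cancel, one_pow] at h2
  refine h.trans (Eq.trans ?_ h2.symm)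
  exact Finset.sum_congr rfl fun k _ => by ring

/-- This is the mean of the binomial law, read off from the first-moment identity of the Bernstein
polynomials. -/
theorem sum_bernoulliWeight_mul_ones (p : ℝ) (n : ℕ) :
    ∑ s : Fin n → Bool, bernoulliWeight p s * (ones s : ℝ) = n * p := by
  have h := sum_comp_ones n fun k => p ^ k * (1 - p) ^ (n - k) * k
  simp only [bernoulliWeight]
  rw [h]
  have h2 := congrArg (Polynomial.eval p) (bernsteinPolynomial.sum_smul ℝ n)
  simp only [Polynomial.eval_finsetSum, bernsteinPolynomial, nsmul_eq_mul, Polynomial.eval_mul,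
    Polynomial.eval_natCast, Polynomial.eval_pow, Polynomial.eval_X, Polynomial.eval_sub,
    Polynomial.eval_one] at h2
  rw [← h2]
  refine Finset.sum_congr rfl fun k _ => by ring

/-- The basic identity of the method of types: the Bernoulli law fitted to the empirical frequency
of `s` has log-likelihood `-n H₂(m_s)` at `s`. The convention `0 log 0 = 0` matches `0 ^ 0 = 1` for
constant patterns. -/
theorem exp_neg_binEntropy_magnetization {n : ℕ} (s : Fin n → Bool) :
    Real.exp (-(n * Real.binEntropy (magnetization s))) = bernoulliWeight (magnetization s) s := by
  rcases Nat.eq_zero_or_pos n with rfl | hn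
  · simp [bernoulliWeight, ones]
  have hn' : (0 : ℝ) < n := by exact_mod_cast hn
  obtain ⟨h0, h1⟩ := magnetization_mem s
  have hk : (ones s : ℝ) = n * magnetization s := by
    rw [magnetization_eq]; field_simp
  have hk' : ((n - ones s : ℕ) : ℝ) = n * (1 - magnetization s) := by
    rw [Nat.cast_sub (ones_le s), hk]; ring
  have key : ∀ (x : ℝ) (k : ℕ), 0 ≤ x → (k : ℝ) = n * x →
      Real.exp (k * Real.log x) = x ^ k := by
    intro x k hx hkx
    rcases hx.eq_or_lt with rfl | hx
    · have : k = 0 := by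
        have : (k : ℝ) = 0 := by simpa using hkx
        exact_mod_cast this
      simp [this]
    · rw [← Real.log_pow, Real.exp_log (pow_pos hx _)]
  rw [bernoulliWeight, ← key _ _ h0 hk, ← key _ _ (by linarith) hk', ← Real.exp_add, hk, hk',
    Real.binEntropy_eq_negMulLog_add_negMulLog_one_sub]
  congr 1
  simp only [Real.negMulLog]
  ring

/-- Each summand is one of the `n + 1` Bernoulli weights with parameter `k / n`, hence at most their
sum, and each of these laws has total mass 1. -/
theorem sum_exp_neg_binEntropy_le (n : ℕ) :
    ∑ s : Fin n → Bool, Real.exp (-(n * Real.binEntropy (magnetization s))) ≤ n + 1 := by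
  have hmem : ∀ k ∈ Finset.range (n + 1), ((k : ℝ) / n) ∈ Set.Icc (0 : ℝ) 1 := by
    intro k hk
    refine ⟨by positivity, div_le_one_of_le₀ ?_ (by positivity)⟩
    exact_mod_cast Nat.lt_succ_iff.mp (Finset.mem_range.mp hk)
  calc ∑ s : Fin n → Bool, Real.exp (-(n * Real.binEntropy (magnetization s)))
      ≤ ∑ s : Fin n → Bool, ∑ k ∈ Finset.range (n + 1), bernoulliWeight ((k : ℝ) / n) s := by
        refine Finset.sum_le_sum fun s _ => ?_
        rw [exp_neg_binEntropy_magnetization, magnetization_eq]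
        exact Finset.single_le_sum (f := fun k : ℕ => bernoulliWeight ((k : ℝ) / n) s)
          (fun k hk => bernoulliWeight_nonneg (hmem k hk) s)
          (Finset.mem_range.mpr (Nat.lt_succ_of_le (ones_le s)))
    _ = n + 1 := by
        rw [Finset.sum_comm]
        simp [sum_bernoulliWeight]

/-- Gibbs' variational inequality on a finite set. -/
theorem sum_mul_log_sub_log_le {ι : Type*} [Fintype ι] (Q w : ι → ℝ) (hQ : ∀ s, 0 ≤ Q s)
    (hQ1 : ∑ s, Q s = 1) (hw : ∀ s, 0 < w s) :
    ∑ s, Q s * (Real.log (w s) - Real.log (Q s)) ≤ Real.log (∑ s, w s) := by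
  have hne : (Finset.univ : Finset ι).Nonempty := by
    by_contra h
    rw [Finset.not_nonempty_iff_eq_empty] at h
    simp [h] at hQ1
  have hZ : 0 < ∑ s, w s := Finset.sum_pos (fun s _ => hw s) hne
  set Z := ∑ s, w s with hZdef
  -- This is `log t ≤ t - 1` at `t = w / (Q Z)`; the corrections `w / Z - Q` sum to zero.
  have key : ∀ s, Q s * (Real.log (w s) - Real.log (Q s)) ≤ Q s * Real.log Z + (w s / Z - Q s) := by
    intro s
    rcases (hQ s).eq_or_lt with h | h
    · rw [← h]; simp only [zero_mul, sub_zero, zero_add]; exact (div_pos (hw s) hZ).le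
    · have h1 := Real.log_le_sub_one_of_pos (div_pos (hw s) (mul_pos h hZ))
      rw [Real.log_div (hw s).ne' (mul_pos h hZ).ne', Real.log_mul h.ne' hZ.ne'] at h1
      have h2 := mul_le_mul_of_nonneg_left h1 h.le
      have h3 : Q s * (w s / (Q s * Z) - 1) = w s / Z - Q s := by
        field_simp
      rw [h3] at h2
      linarith
  calc _ ≤ ∑ s, (Q s * Real.log Z + (w s / Z - Q s)) := Finset.sum_le_sum fun s _ => key s
    _ = Real.log Z := by
      rw [Finset.sum_add_distrib, Finset.sum_sub_distrib, ← Finset.sum_mul, ← Finset.sum_div, hQ1,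
        ← hZdef, div_self hZ.ne']
      ring

/-- The probability of a pattern as a real number. -/
def patternProb (f : ℝ → ℝ) {n : ℕ} (s : Fin n → Bool) : ℝ := patternConst f n * patternWeight f s

theorem patternProb_pos (f : ℝ → ℝ) {n : ℕ} (s : Fin n → Bool) : 0 < patternProb f s :=
  mul_pos (inv_pos.mpr (sum_patternWeight_pos f n)) (Real.exp_pos _)

theorem patternPMF_apply (f : ℝ → ℝ) {n : ℕ} (s : Fin n → Bool) :
    patternPMF f n s = ENNReal.ofReal (patternProb f s) := rfl

theorem patternPMF_toReal (f : ℝ → ℝ) {n : ℕ} (s : Fin n → Bool) :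
    (patternPMF f n s).toReal = patternProb f s := by
  rw [patternPMF_apply, ENNReal.toReal_ofReal (patternProb_pos f s).le]

theorem sum_patternProb (f : ℝ → ℝ) (n : ℕ) : ∑ s : Fin n → Bool, patternProb f s = 1 := by
  simp only [patternProb]
  rw [← Finset.mul_sum, patternConst, inv_mul_cancel₀ (sum_patternWeight_pos f n).ne']

theorem log_patternProb (f : ℝ → ℝ) {n : ℕ} (s : Fin n → Bool) :
    Real.log (patternProb f s) =
      n * f (magnetization s) - Real.log (∑ s : Fin n → Bool, patternWeight f s) := by
  have h : patternConst f n ≠ 0 := (inv_pos.mpr (sum_patternWeight_pos f n)).ne'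
  rw [patternProb, patternWeight, Real.log_mul h (Real.exp_pos _).ne', Real.log_exp, patternConst,
    Real.log_inv]
  ring

theorem entropy_patternPMF (f : ℝ → ℝ) (n : ℕ) :
    entropy (patternPMF f n) = ∑ s : Fin n → Bool, patternProb f s * -Real.log (patternProb f s) := by
  simp only [entropy, patternPMF_toReal, Real.negMulLog]
  exact Finset.sum_congr rfl fun s _ => by ring

theorem entropy_patternPMF_eq_log_sub (f : ℝ → ℝ) (n : ℕ) :
    entropy (patternPMF f n) = Real.log (∑ s : Fin n → Bool, patternWeight f s) -
      n * ∑ s : Fin n → Bool, patternProb f s * f (magnetization s) := by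
  rw [entropy_patternPMF, Finset.mul_sum]
  simp only [log_patternProb]
  set L := Real.log (∑ s : Fin n → Bool, patternWeight f s)
  have h : L = ∑ s : Fin n → Bool, patternProb f s * L := by
    rw [← Finset.sum_mul, sum_patternProb, one_mul]
  conv_rhs => rw [h]
  rw [← Finset.sum_sub_distrib]
  exact Finset.sum_congr rfl fun s _ => by ring

/-- Gibbs' inequality with weights `exp (-n H₂(m_s))`, whose sum is at most `n + 1`: beyond the
number of patterns of a given magnetization, only the magnetization itself contributes, at most
logarithmically. -/
theorem entropy_patternPMF_le (f : ℝ → ℝ) (n : ℕ) :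
    entropy (patternPMF f n) ≤
      n * ∑ s : Fin n → Bool, patternProb f s * Real.binEntropy (magnetization s) +
        Real.log (n + 1) := by
  have h := sum_mul_log_sub_log_le (fun s : Fin n → Bool => patternProb f s)
    (fun s => Real.exp (-(n * Real.binEntropy (magnetization s))))
    (fun s => (patternProb_pos f s).le) (sum_patternProb f n) fun s => Real.exp_pos _
  have h2 : Real.log (∑ s : Fin n → Bool, Real.exp (-(n * Real.binEntropy (magnetization s)))) ≤
      Real.log (n + 1) :=
    Real.log_le_log (Finset.sum_pos (fun _ _ => Real.exp_pos _) Finset.univ_nonempty)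
      (sum_exp_neg_binEntropy_le n)
  have h3 : ∑ s : Fin n → Bool, patternProb f s *
      (Real.log (Real.exp (-(n * Real.binEntropy (magnetization s)))) -
        Real.log (patternProb f s)) = entropy (patternPMF f n) -
      n * ∑ s : Fin n → Bool, patternProb f s * Real.binEntropy (magnetization s) := by
    rw [entropy_patternPMF, Finset.mul_sum, ← Finset.sum_sub_distrib]
    refine Finset.sum_congr rfl fun s _ => ?_
    rw [Real.log_exp]; ring
  linarith

/-- Gibbs' inequality with the i.i.d. Bernoulli law as trial law, whose entropy is `n H₂(p)`. -/
theorem le_log_sum_patternWeight (f : ℝ → ℝ) (n : ℕ) {p : ℝ} (hp : p ∈ Set.Icc (0 : ℝ) 1) :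
    n * ∑ s : Fin n → Bool, bernoulliWeight p s * f (magnetization s) + n * Real.binEntropy p ≤
      Real.log (∑ s : Fin n → Bool, patternWeight f s) := by
  have h := sum_mul_log_sub_log_le (fun s : Fin n → Bool => bernoulliWeight p s)
    (fun s => patternWeight f s) (bernoulliWeight_nonneg hp) (sum_bernoulliWeight p n)
    fun s => Real.exp_pos _
  refine le_trans (le_of_eq ?_) h
  have key : ∀ s : Fin n → Bool, bernoulliWeight p s * (Real.log (patternWeight f s) -
      Real.log (bernoulliWeight p s)) = n * (bernoulliWeight p s * f (magnetization s)) -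
      (bernoulliWeight p s * ones s * Real.log p +
        (n * bernoulliWeight p s - bernoulliWeight p s * ones s) * Real.log (1 - p)) := by
    intro s
    by_cases h0 : bernoulliWeight p s = 0
    · simp [h0]
    · have h1 := left_ne_zero_of_mul h0
      have h2 := right_ne_zero_of_mul h0
      have : Real.log (bernoulliWeight p s) =
          ones s * Real.log p + (n - ones s) * Real.log (1 - p) := by
        rw [bernoulliWeight, Real.log_mul h1 h2, Real.log_pow, Real.log_pow,
          Nat.cast_sub (ones_le s)]
      rw [this, patternWeight, Real.log_exp]
      ring
  simp only [key]
  rw [Finset.sum_sub_distrib, Finset.sum_add_distrib, ← Finset.sum_mul, ← Finset.sum_mul,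
    Finset.sum_sub_distrib, ← Finset.mul_sum, ← Finset.mul_sum, sum_bernoulliWeight_mul_ones,
    sum_bernoulliWeight, Real.binEntropy_eq_negMulLog_add_negMulLog_one_sub]
  simp only [Real.negMulLog]
  ring

/-- Grouped by the number of ones, the sum is the Bernstein polynomial of `f` at `p`, so Bernstein's
approximation theorem applies. -/
theorem tendsto_sum_bernoulliWeight {f : ℝ → ℝ} (hf : ContinuousOn f (Set.Icc 0 1)) {p : ℝ}
    (hp : p ∈ Set.Icc (0 : ℝ) 1) :
    Tendsto (fun n : ℕ => ∑ s : Fin n → Bool, bernoulliWeight p s * f (magnetization s)) atTop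
      (𝓝 (f p)) := by
  let g : C(unitInterval, ℝ) := ⟨fun x => f x, hf.domRestrict⟩
  have h := ((ContinuousEvalConst.continuous_eval_const (F := C(unitInterval, ℝ))
    (⟨p, hp⟩ : unitInterval)).tendsto g).comp
    (bernsteinApproximation_uniform g)
  refine h.congr fun n => ?_
  simp only [Function.comp_apply, bernsteinApproximation.apply]
  have h2 := sum_comp_ones n fun k => p ^ k * (1 - p) ^ (n - k) * f ((k : ℝ) / n)
  simp only [magnetization_eq, bernoulliWeight]
  rw [h2, Finset.sum_range]
  refine Finset.sum_congr rfl fun k _ => ?_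
  simp only [bernstein_apply, smul_eq_mul]
  change _ * f ((k : ℝ) / n) = _
  ring

/-- The set where `H₂` is at least `H₂(a) + ε` is compact and misses `a`, so the gap of `H₂ + f` to
its maximum has a positive minimum `η` there. Since `H₂ ≤ log 2`, the slope `C = log 2 / η`
suffices. A bound affine in the gap can be averaged over patterns, which replaces any concentration
estimate for `m_s`. -/
theorem exists_binEntropy_le_add {f : ℝ → ℝ} (hf : ContinuousOn f (Set.Icc 0 1))
    {a : ℝ} (ha : a ∈ Set.Icc (0 : ℝ) 1) (hmax : ∀ m ∈ Set.Icc (0 : ℝ) 1, m ≠ a →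
      Real.binEntropy m + f m < Real.binEntropy a + f a) {ε : ℝ} (hε : 0 < ε) :
    ∃ C, 0 ≤ C ∧ ∀ m ∈ Set.Icc (0 : ℝ) 1, Real.binEntropy m ≤ Real.binEntropy a + ε +
      C * ((Real.binEntropy a + f a) - (Real.binEntropy m + f m)) := by
  set K := Set.Icc (0 : ℝ) 1 ∩ Real.binEntropy ⁻¹' Set.Ici (Real.binEntropy a + ε) with hK
  have hKc : IsCompact K :=
    isCompact_Icc.inter_right (isClosed_Ici.preimage Real.binEntropy_continuous)
  have hle : ∀ m ∈ Set.Icc (0 : ℝ) 1,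
      0 ≤ (Real.binEntropy a + f a) - (Real.binEntropy m + f m) := by
    intro m hm
    by_cases h : m = a
    · simp [h]
    · linarith [hmax m hm h]
  have hcont : ContinuousOn
      (fun m => (Real.binEntropy a + f a) - (Real.binEntropy m + f m)) K :=
    continuousOn_const.sub (Real.binEntropy_continuous.continuousOn.add
      (hf.mono Set.inter_subset_left))
  rcases K.eq_empty_or_nonempty with hKe | hKn
  · refine ⟨0, le_rfl, fun m hm => ?_⟩
    by_contra hcon
    push Not at hcon
    have : m ∈ K := ⟨hm, by simp only [Set.mem_preimage, Set.mem_Ici]; linarith⟩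
    simp [hKe] at this
  · obtain ⟨x, hx, hxmin⟩ := hKc.exists_isMinOn hKn hcont
    have hxa : x ≠ a := by
      rintro rfl
      have := hx.2
      simp only [Set.mem_preimage, Set.mem_Ici] at this
      linarith
    have hη := sub_pos.mpr (hmax x hx.1 hxa)
    set η := (Real.binEntropy a + f a) - (Real.binEntropy x + f x)
    refine ⟨Real.log 2 / η, div_nonneg (Real.log_nonneg (by norm_num)) hη.le, fun m hm => ?_⟩
    by_cases hmK : m ∈ K
    · have h1 : η ≤ (Real.binEntropy a + f a) - (Real.binEntropy m + f m) := hxmin hmK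
      have h2 : Real.log 2 / η * η ≤
          Real.log 2 / η * ((Real.binEntropy a + f a) - (Real.binEntropy m + f m)) :=
        mul_le_mul_of_nonneg_left h1 (div_nonneg (Real.log_nonneg (by norm_num)) hη.le)
      rw [div_mul_cancel₀ _ hη.ne'] at h2
      have h3 := Real.binEntropy_le_log_two (p := m)
      have h4 : 0 ≤ Real.binEntropy a := Real.binEntropy_nonneg ha.1 ha.2
      linarith
    · have h1 : Real.binEntropy m < Real.binEntropy a + ε := by
        by_contra hcon
        push Not at hcon
        exact hmK ⟨hm, hcon⟩
      have := mul_nonneg (div_nonneg (Real.log_nonneg one_le_two) hη.le) (hle m hm)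
      linarith

/-- The entropy rate of the pattern is asymptotically at most `H₂(a)`. -/
theorem eventually_entropy_patternPMF_le {f : ℝ → ℝ} (hf : ContinuousOn f (Set.Icc 0 1))
    {a : ℝ} (ha : a ∈ Set.Icc (0 : ℝ) 1) (hmax : ∀ m ∈ Set.Icc (0 : ℝ) 1, m ≠ a →
      Real.binEntropy m + f m < Real.binEntropy a + f a) {ε : ℝ} (hε : 0 < ε) :
    ∀ᶠ n : ℕ in atTop, entropy (patternPMF f n) ≤ n * (Real.binEntropy a + ε) := by
  obtain ⟨C, hC, hCle⟩ := exists_binEntropy_le_add hf ha hmax (half_pos hε)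
  have hlog : Tendsto (fun n : ℕ => Real.log ((n : ℝ) + 1) / n) atTop (𝓝 0) := by
    have h1 : Tendsto (fun x : ℝ => Real.log (x + 1) / x) atTop (𝓝 0) := by
      have h := (Real.isLittleO_log_id_atTop.tendsto_div_nhds_zero).comp
        (tendsto_atTop_add_const_right atTop (1 : ℝ) tendsto_id)
      have h2 : Tendsto (fun x : ℝ => (x + 1) / x) atTop (𝓝 1) := by
        have : Tendsto (fun x : ℝ => 1 + x⁻¹) atTop (𝓝 (1 + 0)) :=
          tendsto_const_nhds.add tendsto_inv_atTop_zero
        rw [add_zero] at this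
        refine this.congr' ?_
        filter_upwards [eventually_gt_atTop 0] with x hx
        field_simp
      have h3 := h.mul h2
      rw [zero_mul] at h3
      refine h3.congr' ?_
      filter_upwards [eventually_gt_atTop 0] with x hx
      simp only [Function.comp_apply, id]
      field_simp
    exact h1.comp tendsto_natCast_atTop_atTop
  have hlim : Tendsto (fun n : ℕ => C * ((f a - ∑ s : Fin n → Bool, bernoulliWeight a s *
      f (magnetization s)) + Real.log ((n : ℝ) + 1) / n) + Real.log ((n : ℝ) + 1) / n) atTop
      (𝓝 (C * ((f a - f a) + 0) + 0)) :=
    (((tendsto_const_nhds.sub (tendsto_sum_bernoulliWeight hf ha)).add hlog).const_mul C).add hlog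
  rw [sub_self, add_zero, add_zero, mul_zero] at hlim
  filter_upwards [hlim.eventually (gt_mem_nhds (half_pos hε)), eventually_gt_atTop 0] with n hn hn0
  have hn' : (0 : ℝ) < n := by exact_mod_cast hn0
  set B := ∑ s : Fin n → Bool, bernoulliWeight a s * f (magnetization s)
  set L := Real.log ((n : ℝ) + 1) with hL
  have h1 := le_log_sum_patternWeight f n ha
  have h2 := entropy_patternPMF_le f n
  have h3 := entropy_patternPMF_eq_log_sub f n
  set EH := ∑ s : Fin n → Bool, patternProb f s * Real.binEntropy (magnetization s) with hEH
  set Ef := ∑ s : Fin n → Bool, patternProb f s * f (magnetization s) with hEf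
  -- The affine bound averaged over the pattern law.
  have h4 : EH ≤ Real.binEntropy a + ε / 2 + C * ((Real.binEntropy a + f a) - (EH + Ef)) := by
    have : ∑ s : Fin n → Bool, patternProb f s * Real.binEntropy (magnetization s) ≤
        ∑ s : Fin n → Bool, patternProb f s * (Real.binEntropy a + ε / 2 +
          C * ((Real.binEntropy a + f a) -
            (Real.binEntropy (magnetization s) + f (magnetization s)))) :=
      Finset.sum_le_sum fun s _ => mul_le_mul_of_nonneg_left (hCle _ (magnetization_mem s))
        (patternProb_pos f s).le
    refine this.trans (le_of_eq ?_)
    have : ∀ s : Fin n → Bool, patternProb f s * (Real.binEntropy a + ε / 2 +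
          C * ((Real.binEntropy a + f a) -
            (Real.binEntropy (magnetization s) + f (magnetization s)))) =
        patternProb f s * (Real.binEntropy a + ε / 2 + C * (Real.binEntropy a + f a)) -
        C * (patternProb f s * Real.binEntropy (magnetization s) +
          patternProb f s * f (magnetization s)) := fun s => by ring
    simp only [this]
    rw [Finset.sum_sub_distrib, ← Finset.sum_mul, ← Finset.mul_sum, Finset.sum_add_distrib,
      sum_patternProb]
    ring
  -- The log partition function is at least `n (B + H₂(a))` by the trial law, and equals the entropy
  -- plus `n Ef`, hence is at most `n (EH + Ef) + L`.
  have h5 : (Real.binEntropy a + f a) - (EH + Ef) ≤ (f a - B) + L / n := by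
    have : n * ((Real.binEntropy a + f a) - (EH + Ef)) ≤ n * ((f a - B) + L / n) := by
      have : n * ((f a - B) + L / n) = n * (f a - B) + L := by field_simp
      rw [this]
      nlinarith
    exact le_of_mul_le_mul_left this hn'
  have h6 := mul_le_mul_of_nonneg_left h5 hC
  have h7 : EH + L / n ≤ Real.binEntropy a + ε := by linarith
  calc entropy (patternPMF f n) ≤ n * EH + L := h2
    _ = n * (EH + L / n) := by field_simp
    _ ≤ _ := mul_le_mul_of_nonneg_left h7 hn'.le

end SparseCoding

/-! ### Information densities and conditional mutual information -/

namespace SparseCoding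

theorem integrable_of_lintegral_eq_one {Ω : Type*} [MeasurableSpace Ω] {μ : Measure Ω} {g : Ω → ℝ}
    (hg : Measurable g) (h0 : ∀ ω, 0 ≤ g ω) (h1 : ∫⁻ ω, ENNReal.ofReal (g ω) ∂μ = 1) :
    Integrable g μ ∧ ∫ ω, g ω ∂μ = 1 := by
  refine ⟨⟨hg.aestronglyMeasurable, ?_⟩, ?_⟩
  · rw [hasFiniteIntegral_iff_ofReal (ae_of_all _ h0), h1]
    exact ENNReal.one_lt_top
  · rw [integral_eq_lintegral_of_nonneg_ae (ae_of_all _ h0) hg.aestronglyMeasurable, h1]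
    simp

section ChannelDensity

set_option linter.unusedSectionVars false

variable {Ω 𝓥 𝓨 𝓩 : Type*} [MeasurableSpace Ω] [MeasurableSpace 𝓥] [MeasurableSpace 𝓨]
  [MeasurableSpace 𝓩]

/-- The law of `(Z, V, Y)` has the density `D ≤ exp G` with respect to `ζ ⊗ π ⊗ lam`, where `ζ` and
`π` are the laws of the independent variables `Z` and `V`. -/
structure HasChannelDensity (D : 𝓩 → 𝓥 → 𝓨 → ℝ) (G : 𝓨 → ℝ) (ζ : Measure 𝓩) (π : Measure 𝓥)
    (lam : Measure 𝓨) (μ : Measure Ω) (Z : Ω → 𝓩) (V : Ω → 𝓥) (Y : Ω → 𝓨) : Prop where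
  measurable_Z : Measurable Z
  measurable_V : Measurable V
  measurable_Y : Measurable Y
  measurable : Measurable fun t : 𝓩 × 𝓥 × 𝓨 => D t.1 t.2.1 t.2.2
  pos : ∀ z v y, 0 < D z v y
  le_exp : ∀ z v y, D z v y ≤ Real.exp (G y)
  lintegral_eq_one : ∀ z v, ∫⁻ y, ENNReal.ofReal (D z v y) ∂lam = 1
  lintegral_comp : ∀ g : 𝓩 × 𝓥 × 𝓨 → ℝ≥0∞, Measurable g →
    ∫⁻ ω, g (Z ω, V ω, Y ω) ∂μ =
      ∫⁻ z, ∫⁻ v, ∫⁻ y, ENNReal.ofReal (D z v y) * g (z, v, y) ∂lam ∂π ∂ζ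

/-- The density of the output given `Z`. -/
def outDensity (D : 𝓩 → 𝓥 → 𝓨 → ℝ) (π : Measure 𝓥) (z : 𝓩) (y : 𝓨) : ℝ :=
  (∫⁻ v, ENNReal.ofReal (D z v y) ∂π).toReal

/-- The conditional information density. -/
def infoDensity (D : 𝓩 → 𝓥 → 𝓨 → ℝ) (π : Measure 𝓥) (z : 𝓩) (v : 𝓥) (y : 𝓨) : ℝ :=
  Real.log (D z v y / outDensity D π z y)

namespace HasChannelDensity

variable {D : 𝓩 → 𝓥 → 𝓨 → ℝ} {G : 𝓨 → ℝ} {ζ : Measure 𝓩} {π : Measure 𝓥}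
    {lam : Measure 𝓨} {μ : Measure Ω} {Z : Ω → 𝓩} {V : Ω → 𝓥} {Y : Ω → 𝓨}
    [IsProbabilityMeasure ζ] [IsProbabilityMeasure π] [IsProbabilityMeasure lam]
    [IsProbabilityMeasure μ]

theorem measurable_section (h : HasChannelDensity D G ζ π lam μ Z V Y) (z : 𝓩) (y : 𝓨) :
    Measurable fun v => D z v y :=
  h.measurable.comp (f := fun v => (z, v, y)) (by fun_prop)

theorem lintegral_le (h : HasChannelDensity D G ζ π lam μ Z V Y) (z : 𝓩) (y : 𝓨) :
    ∫⁻ v, ENNReal.ofReal (D z v y) ∂π ≤ ENNReal.ofReal (Real.exp (G y)) :=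
  calc ∫⁻ v, ENNReal.ofReal (D z v y) ∂π ≤ ∫⁻ _, ENNReal.ofReal (Real.exp (G y)) ∂π :=
        lintegral_mono fun v => ENNReal.ofReal_le_ofReal (h.le_exp z v y)
    _ = _ := by simp

theorem ofReal_outDensity (h : HasChannelDensity D G ζ π lam μ Z V Y) (z : 𝓩) (y : 𝓨) :
    ENNReal.ofReal (outDensity D π z y) = ∫⁻ v, ENNReal.ofReal (D z v y) ∂π :=
  ENNReal.ofReal_toReal ((h.lintegral_le z y).trans_lt ENNReal.ofReal_lt_top).ne

theorem outDensity_pos (h : HasChannelDensity D G ζ π lam μ Z V Y) (z : 𝓩) (y : 𝓨) :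
    0 < outDensity D π z y := by
  rw [← ENNReal.ofReal_pos, h.ofReal_outDensity,
    lintegral_pos_iff_support (h.measurable_section z y).ennreal_ofReal]
  have : (Function.support fun v => ENNReal.ofReal (D z v y)) = Set.univ := by
    ext v; simp [h.pos z v y]
  simp [this]

theorem measurable_outDensity (h : HasChannelDensity D G ζ π lam μ Z V Y) :
    Measurable fun t : 𝓩 × 𝓨 => outDensity D π t.1 t.2 := by
  refine Measurable.ennreal_toReal ?_
  exact Measurable.lintegral_prod_right' (ν := π)
    (f := fun s : (𝓩 × 𝓨) × 𝓥 => ENNReal.ofReal (D s.1.1 s.2 s.1.2))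
    ((h.measurable.comp (f := fun s : (𝓩 × 𝓨) × 𝓥 => (s.1.1, s.2, s.1.2))
      (by fun_prop)).ennreal_ofReal)

theorem measurable_ratio (h : HasChannelDensity D G ζ π lam μ Z V Y) :
    Measurable fun t : 𝓩 × 𝓥 × 𝓨 => D t.1 t.2.1 t.2.2 / outDensity D π t.1 t.2.2 :=
  h.measurable.div
    (h.measurable_outDensity.comp (f := fun t : 𝓩 × 𝓥 × 𝓨 => (t.1, t.2.2)) (by fun_prop))

theorem measurable_infoDensity (h : HasChannelDensity D G ζ π lam μ Z V Y) :
    Measurable fun t : 𝓩 × 𝓥 × 𝓨 => infoDensity D π t.1 t.2.1 t.2.2 :=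
  h.measurable_ratio.log

theorem ratio_pos (h : HasChannelDensity D G ζ π lam μ Z V Y) (z : 𝓩) (v : 𝓥) (y : 𝓨) :
    0 < D z v y / outDensity D π z y :=
  div_pos (h.pos z v y) (h.outDensity_pos z y)

/-- The law of `(Z, Y)`. -/
theorem lintegral_comp_out (h : HasChannelDensity D G ζ π lam μ Z V Y) (g : 𝓩 × 𝓨 → ℝ≥0∞)
    (hg : Measurable g) :
    ∫⁻ ω, g (Z ω, Y ω) ∂μ =
      ∫⁻ z, ∫⁻ y, ENNReal.ofReal (outDensity D π z y) * g (z, y) ∂lam ∂ζ := by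
  rw [h.lintegral_comp (fun t => g (t.1, t.2.2)) (by fun_prop)]
  refine lintegral_congr fun z => ?_
  have hm : Measurable fun t : 𝓥 × 𝓨 => ENNReal.ofReal (D z t.1 t.2) :=
    (h.measurable.comp (f := fun t : 𝓥 × 𝓨 => (z, t.1, t.2)) (by fun_prop)).ennreal_ofReal
  rw [lintegral_lintegral_swap (by
    exact (hm.mul (hg.comp (f := fun t : 𝓥 × 𝓨 => (z, t.2)) (by fun_prop))).aemeasurable)]
  refine lintegral_congr fun y => ?_
  dsimp only
  rw [lintegral_mul_const _ (h.measurable_section z y).ennreal_ofReal, h.ofReal_outDensity]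

theorem lintegral_outDensity (h : HasChannelDensity D G ζ π lam μ Z V Y) (z : 𝓩) :
    ∫⁻ y, ENNReal.ofReal (outDensity D π z y) ∂lam = 1 := by
  have hm : Measurable fun t : 𝓨 × 𝓥 => ENNReal.ofReal (D z t.2 t.1) :=
    (h.measurable.comp (f := fun t : 𝓨 × 𝓥 => (z, t.2, t.1)) (by fun_prop)).ennreal_ofReal
  simp only [h.ofReal_outDensity]
  rw [lintegral_lintegral_swap hm.aemeasurable]
  simp [h.lintegral_eq_one]

/-- The reciprocal of the likelihood ratio turns the density `D` into the output density, which
integrates to 1. This controls the negative part of the information density. -/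
theorem lintegral_inv_ratio (h : HasChannelDensity D G ζ π lam μ Z V Y) :
    ∫⁻ ω, ENNReal.ofReal ((D (Z ω) (V ω) (Y ω) / outDensity D π (Z ω) (Y ω))⁻¹) ∂μ = 1 := by
  rw [h.lintegral_comp (fun t => ENNReal.ofReal ((D t.1 t.2.1 t.2.2 /
    outDensity D π t.1 t.2.2)⁻¹)) h.measurable_ratio.inv.ennreal_ofReal]
  have : ∀ z v y, ENNReal.ofReal (D z v y) * ENNReal.ofReal ((D z v y / outDensity D π z y)⁻¹) =
      ENNReal.ofReal (outDensity D π z y) := by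
    intro z v y
    rw [← ENNReal.ofReal_mul (h.pos z v y).le, inv_div, mul_div_cancel₀ _ (h.pos z v y).ne']
  simp only [this, h.lintegral_outDensity, lintegral_const, measure_univ, mul_one]

theorem lintegral_inv_outDensity (h : HasChannelDensity D G ζ π lam μ Z V Y) :
    ∫⁻ ω, ENNReal.ofReal ((outDensity D π (Z ω) (Y ω))⁻¹) ∂μ = 1 := by
  rw [h.lintegral_comp_out (fun t => ENNReal.ofReal ((outDensity D π t.1 t.2)⁻¹))
    h.measurable_outDensity.inv.ennreal_ofReal]
  have : ∀ z y, ENNReal.ofReal (outDensity D π z y) *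
      ENNReal.ofReal ((outDensity D π z y)⁻¹) = 1 := by
    intro z y
    rw [← ENNReal.ofReal_mul (h.outDensity_pos z y).le, mul_inv_cancel₀ (h.outDensity_pos z y).ne',
      ENNReal.ofReal_one]
  simp [this]

theorem measurable_infoDensity_comp (h : HasChannelDensity D G ζ π lam μ Z V Y) :
    Measurable fun ω => infoDensity D π (Z ω) (V ω) (Y ω) :=
  h.measurable_infoDensity.comp
    (h.measurable_Z.prodMk (h.measurable_V.prodMk h.measurable_Y))

/-- With likelihood ratio `r` and output density `d`, one has `1 - 1/r ≤ log r ≤ G + (1/d - 1)`,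
using `log D ≤ G` and `-log d ≤ 1/d - 1`. Both `1/r` and `1/d` have mean 1, so the sandwich is
integrable and the upper correction has mean zero. -/
theorem integrable_infoDensity (h : HasChannelDensity D G ζ π lam μ Z V Y)
    (hG : Integrable (fun ω => G (Y ω)) μ) :
    Integrable (fun ω => infoDensity D π (Z ω) (V ω) (Y ω)) μ ∧
      ∫ ω, infoDensity D π (Z ω) (V ω) (Y ω) ∂μ ≤ ∫ ω, G (Y ω) ∂μ := by
  have hZVY := h.measurable_Z.prodMk (h.measurable_V.prodMk h.measurable_Y)
  obtain ⟨i1, -⟩ := integrable_of_lintegral_eq_one (μ := μ)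
    (g := fun ω => (D (Z ω) (V ω) (Y ω) / outDensity D π (Z ω) (Y ω))⁻¹)
    (h.measurable_ratio.inv.comp hZVY) (fun ω => (inv_pos.mpr (h.ratio_pos _ _ _)).le)
    h.lintegral_inv_ratio
  obtain ⟨i2, e2⟩ := integrable_of_lintegral_eq_one (μ := μ)
    (g := fun ω => (outDensity D π (Z ω) (Y ω))⁻¹)
    (h.measurable_outDensity.inv.comp (h.measurable_Z.prodMk h.measurable_Y))
    (fun ω => (inv_pos.mpr (h.outDensity_pos _ _)).le) h.lintegral_inv_outDensity
  have lower : ∀ ω, 1 - (D (Z ω) (V ω) (Y ω) / outDensity D π (Z ω) (Y ω))⁻¹ ≤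
      infoDensity D π (Z ω) (V ω) (Y ω) := fun ω =>
    Real.one_sub_inv_le_log_of_pos (h.ratio_pos _ _ _)
  have upper : ∀ ω, infoDensity D π (Z ω) (V ω) (Y ω) ≤
      G (Y ω) + ((outDensity D π (Z ω) (Y ω))⁻¹ - 1) := by
    intro ω
    rw [infoDensity, div_eq_mul_inv, Real.log_mul (h.pos _ _ _).ne'
      (inv_pos.mpr (h.outDensity_pos _ _)).ne']
    refine add_le_add ?_ (Real.log_le_sub_one_of_pos (inv_pos.mpr (h.outDensity_pos _ _)))
    rw [← Real.log_exp (G (Y ω))]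
    exact Real.log_le_log (h.pos _ _ _) (h.le_exp _ _ _)
  have iu : Integrable (fun ω => G (Y ω) + ((outDensity D π (Z ω) (Y ω))⁻¹ - 1)) μ :=
    hG.add (i2.sub (integrable_const 1))
  have ir : Integrable (fun ω => infoDensity D π (Z ω) (V ω) (Y ω)) μ :=
    integrable_of_le_of_le h.measurable_infoDensity_comp.aestronglyMeasurable
      (ae_of_all _ lower) (ae_of_all _ upper) ((integrable_const 1).sub i1) iu
  refine ⟨ir, ?_⟩
  calc ∫ ω, infoDensity D π (Z ω) (V ω) (Y ω) ∂μ ≤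
      ∫ ω, (G (Y ω) + ((outDensity D π (Z ω) (Y ω))⁻¹ - 1)) ∂μ :=
        integral_mono ir iu upper
    _ = ∫ ω, G (Y ω) ∂μ := by
      have e3 : ∫ ω, ((outDensity D π (Z ω) (Y ω))⁻¹ - 1) ∂μ = 0 := by
        rw [integral_sub i2 (integrable_const 1), e2]
        simp
      have i3 : Integrable (fun ω => (outDensity D π (Z ω) (Y ω))⁻¹ - 1) μ :=
        i2.sub (integrable_const 1)
      rw [integral_add hG i3, e3, add_zero]

theorem map_Z (h : HasChannelDensity D G ζ π lam μ Z V Y) : μ.map Z = ζ := by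
  refine Measure.ext_of_lintegral _ fun g hg => ?_
  rw [lintegral_map hg h.measurable_Z, h.lintegral_comp (fun t => g t.1) (by fun_prop)]
  refine lintegral_congr fun z => ?_
  have hm : ∀ v, Measurable fun y => ENNReal.ofReal (D z v y) := fun v =>
    (h.measurable.comp (f := fun y => (z, v, y)) (by fun_prop)).ennreal_ofReal
  simp [lintegral_mul_const _ (hm _), h.lintegral_eq_one]

theorem map_ZV (h : HasChannelDensity D G ζ π lam μ Z V Y) :
    μ.map (fun ω => (Z ω, V ω)) = ζ.prod π := by
  refine Measure.ext_of_lintegral _ fun g hg => ?_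
  rw [lintegral_map hg (h.measurable_Z.prodMk h.measurable_V),
    h.lintegral_comp (fun t => g (t.1, t.2.1)) (by fun_prop), lintegral_prod _ hg.aemeasurable]
  refine lintegral_congr fun z => lintegral_congr fun v => ?_
  have hm : Measurable fun y => ENNReal.ofReal (D z v y) :=
    (h.measurable.comp (f := fun y => (z, v, y)) (by fun_prop)).ennreal_ofReal
  dsimp only
  rw [lintegral_mul_const _ hm, h.lintegral_eq_one, one_mul]

variable [StandardBorelSpace 𝓥] [Nonempty 𝓥] [StandardBorelSpace 𝓨] [Nonempty 𝓨]

/-- Independence of `V` and `Z` makes the conditional law of `V` constantly `π`; the conditional law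
of `Y` enters only through the law of `(Z, Y)`, which has density `outDensity`. -/
theorem lintegral_compProd_condDistrib (h : HasChannelDensity D G ζ π lam μ Z V Y)
    (g : 𝓩 × 𝓥 × 𝓨 → ℝ≥0∞) (hg : Measurable g) :
    ∫⁻ t, g t ∂((μ.map Z) ⊗ₘ (condDistrib V Z μ ×ₖ condDistrib Y Z μ)) =
      ∫⁻ z, ∫⁻ v, ∫⁻ y, ENNReal.ofReal (outDensity D π z y) * g (z, v, y) ∂lam ∂π ∂ζ := by
  have hV : condDistrib V Z μ =ᵐ[μ.map Z] Kernel.const 𝓩 π := by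
    refine condDistrib_ae_eq_of_measure_eq_compProd Z h.measurable_V.aemeasurable ?_
    rw [h.map_ZV, h.map_Z, Measure.compProd_const]
  have hprod : (condDistrib V Z μ ×ₖ condDistrib Y Z μ) =ᵐ[μ.map Z]
      (Kernel.const 𝓩 π ×ₖ condDistrib Y Z μ) := by
    filter_upwards [hV] with z hz
    rw [Kernel.prod_apply, Kernel.prod_apply, hz]
  have hH : Measurable fun t : 𝓩 × 𝓨 => ∫⁻ v, g (t.1, v, t.2) ∂π :=
    Measurable.lintegral_prod_right' (ν := π) (f := fun s : (𝓩 × 𝓨) × 𝓥 => g (s.1.1, s.2, s.1.2))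
      (hg.comp (by fun_prop))
  rw [Measure.compProd_congr hprod, Measure.lintegral_compProd hg]
  calc ∫⁻ z, ∫⁻ b, g (z, b) ∂((Kernel.const 𝓩 π ×ₖ condDistrib Y Z μ) z) ∂(μ.map Z)
      = ∫⁻ z, ∫⁻ y, ∫⁻ v, g (z, v, y) ∂π ∂(condDistrib Y Z μ z) ∂(μ.map Z) := by
        refine lintegral_congr fun z => ?_
        rw [Kernel.prod_apply, Kernel.const_apply]
        exact lintegral_prod_symm _
          (hg.comp (f := fun b : 𝓥 × 𝓨 => (z, b)) (by fun_prop)).aemeasurable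
    _ = ∫⁻ t, ∫⁻ v, g (t.1, v, t.2) ∂π ∂((μ.map Z) ⊗ₘ condDistrib Y Z μ) := by
        rw [Measure.lintegral_compProd hH]
    _ = ∫⁻ ω, ∫⁻ v, g (Z ω, v, Y ω) ∂π ∂μ := by
        rw [compProd_map_condDistrib h.measurable_Y.aemeasurable,
          lintegral_map hH (h.measurable_Z.prodMk h.measurable_Y)]
    _ = ∫⁻ z, ∫⁻ y, ENNReal.ofReal (outDensity D π z y) * ∫⁻ v, g (z, v, y) ∂π ∂lam ∂ζ :=
        h.lintegral_comp_out (fun t => ∫⁻ v, g (t.1, v, t.2) ∂π) hH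
    _ = _ := by
        refine lintegral_congr fun z => ?_
        have hgm : Measurable fun t : 𝓨 × 𝓥 => g (z, t.2, t.1) := hg.comp (by fun_prop)
        have hq : Measurable fun t : 𝓨 × 𝓥 => ENNReal.ofReal (outDensity D π z t.1) :=
          (h.measurable_outDensity.comp (f := fun t : 𝓨 × 𝓥 => (z, t.1)) (by fun_prop)).ennreal_ofReal
        rw [← lintegral_lintegral_swap (hq.mul hgm).aemeasurable]
        refine lintegral_congr fun y => ?_
        exact (lintegral_const_mul _ (hgm.comp (f := fun v => (y, v)) (by fun_prop))).symm

theorem map_eq_withDensity (h : HasChannelDensity D G ζ π lam μ Z V Y) :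
    μ.map (fun ω => (Z ω, V ω, Y ω)) =
      ((μ.map Z) ⊗ₘ (condDistrib V Z μ ×ₖ condDistrib Y Z μ)).withDensity
        fun t => ENNReal.ofReal (D t.1 t.2.1 t.2.2 / outDensity D π t.1 t.2.2) := by
  refine Measure.ext_of_lintegral _ fun g hg => ?_
  have hr := h.measurable_ratio.ennreal_ofReal
  rw [lintegral_map hg (h.measurable_Z.prodMk (h.measurable_V.prodMk h.measurable_Y)),
    h.lintegral_comp g hg, lintegral_withDensity_eq_lintegral_mul _ hr hg,
    h.lintegral_compProd_condDistrib _ (hr.mul hg)]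
  refine lintegral_congr fun z => lintegral_congr fun v => lintegral_congr fun y => ?_
  rw [Pi.mul_apply, ← mul_assoc, ← ENNReal.ofReal_mul (h.outDensity_pos z y).le,
    mul_div_cancel₀ _ (h.outDensity_pos z y).ne']

theorem condMutualInfo_eq (h : HasChannelDensity D G ζ π lam μ Z V Y)
    (hG : Integrable (fun ω => G (Y ω)) μ) :
    condMutualInfo V Y Z μ =
      ENNReal.ofReal (∫ ω, infoDensity D π (Z ω) (V ω) (Y ω) ∂μ) := by
  have hZVY : Measurable fun ω => (Z ω, V ω, Y ω) :=
    h.measurable_Z.prodMk (h.measurable_V.prodMk h.measurable_Y)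
  set T := (μ.map Z) ⊗ₘ (condDistrib V Z μ ×ₖ condDistrib Y Z μ) with hT
  set J := μ.map (fun ω => (Z ω, V ω, Y ω)) with hJ
  have hJT := h.map_eq_withDensity
  rw [← hT, ← hJ] at hJT
  have hprobZ : IsProbabilityMeasure (μ.map Z) :=
    Measure.isProbabilityMeasure_map h.measurable_Z.aemeasurable
  have hprobJ : IsProbabilityMeasure J := Measure.isProbabilityMeasure_map hZVY.aemeasurable
  have hac : J ≪ T := hJT ▸ withDensity_absolutelyContinuous _ _
  have hllr : llr J T =ᵐ[J] fun t => infoDensity D π t.1 t.2.1 t.2.2 := by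
    have h1 : J.rnDeriv T =ᵐ[T]
        fun t => ENNReal.ofReal (D t.1 t.2.1 t.2.2 / outDensity D π t.1 t.2.2) := by
      rw [hJT]
      exact Measure.rnDeriv_withDensity _ h.measurable_ratio.ennreal_ofReal
    filter_upwards [hac.ae_le h1] with t ht
    rw [llr, ht, ENNReal.toReal_ofReal (h.ratio_pos _ _ _).le, infoDensity]
  have hint : Integrable (fun t : 𝓩 × 𝓥 × 𝓨 => infoDensity D π t.1 t.2.1 t.2.2) J := by
    rw [hJ, integrable_map_measure h.measurable_infoDensity.aestronglyMeasurable
      hZVY.aemeasurable]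
    exact (h.integrable_infoDensity hG).1
  have hval : ∫ t, infoDensity D π t.1 t.2.1 t.2.2 ∂J =
      ∫ ω, infoDensity D π (Z ω) (V ω) (Y ω) ∂μ := by
    rw [hJ, integral_map hZVY.aemeasurable h.measurable_infoDensity.aestronglyMeasurable]
  rw [condMutualInfo, ← hT, ← hJ,
    InformationTheory.klDiv_of_ac_of_integrable hac ((integrable_congr hllr).mpr hint),
    integral_congr_ae hllr, hval]
  -- The formula for `klDiv` also contains the difference of the total masses; both measures are
  -- probability measures, so it vanishes.
  simp

end HasChannelDensity

end ChannelDensity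

end SparseCoding

/-! ### Product measures with densities -/

namespace SparseCoding

theorem lintegral_pi_prod_eq {ι : Type*} [Fintype ι] {E : ι → Type*} [∀ i, MeasurableSpace (E i)]
    (μ : (i : ι) → Measure (E i)) [∀ i, IsProbabilityMeasure (μ i)] (X : (i : ι) → E i → ℝ≥0∞)
    (hX : ∀ i, Measurable (X i)) :
    ∫⁻ ω, ∏ i, X i (ω i) ∂Measure.pi μ = ∏ i, ∫⁻ x, X i x ∂μ i := by
  have h := lintegral_prod_eq_prod_lintegral_of_indepFun Finset.univ
    (fun i (ω : (i : ι) → E i) => X i (ω i))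
    (iIndepFun_pi (μ := μ) fun i => (hX i).aemeasurable) fun i => (hX i).comp (measurable_pi_apply i)
  refine h.trans ?_
  refine Finset.prod_congr rfl fun i _ => ?_
  exact (measurePreserving_eval μ i).lintegral_comp (hX i)

theorem pi_withDensity {ι : Type*} [Fintype ι] {E : ι → Type*} [∀ i, MeasurableSpace (E i)]
    (μ : (i : ι) → Measure (E i)) [∀ i, IsProbabilityMeasure (μ i)] (d : (i : ι) → E i → ℝ≥0∞)
    (hd : ∀ i, Measurable (d i)) [∀ i, SigmaFinite ((μ i).withDensity (d i))] :
    Measure.pi (fun i => (μ i).withDensity (d i)) =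
      (Measure.pi μ).withDensity fun x => ∏ i, d i (x i) := by
  refine Measure.pi_eq fun s hs => ?_
  rw [withDensity_apply _ (MeasurableSet.univ_pi hs), ← lintegral_indicator (MeasurableSet.univ_pi hs)]
  have : ∀ x, (Set.univ.pi s).indicator (fun x => ∏ i, d i (x i)) x =
      ∏ i, (s i).indicator (d i) (x i) := by
    intro x
    by_cases hx : x ∈ Set.univ.pi s
    · rw [Set.indicator_of_mem hx]
      exact Finset.prod_congr rfl fun i _ => (Set.indicator_of_mem (hx i trivial) _).symm
    · rw [Set.indicator_of_notMem hx]
      simp only [Set.mem_pi, Set.mem_univ, true_imp_iff, not_forall] at hx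
      obtain ⟨i, hi⟩ := hx
      exact (Finset.prod_eq_zero (Finset.mem_univ i) (Set.indicator_of_notMem hi _)).symm
  simp only [this]
  rw [lintegral_pi_prod_eq μ _ fun i => (hd i).indicator (hs i)]
  refine Finset.prod_congr rfl fun i _ => ?_
  rw [lintegral_indicator (hs i), withDensity_apply _ (hs i)]

/-! ### Translated Gaussian noise -/

theorem gaussianReal_eq_withDensity (b : ℝ) :
    gaussianReal b 1 =
      (gaussianReal 0 1).withDensity fun y => ENNReal.ofReal (Real.exp (b * y - b ^ 2 / 2)) := by
  rw [gaussianReal_of_var_ne_zero b one_ne_zero, gaussianReal_of_var_ne_zero 0 one_ne_zero,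
    ← withDensity_mul _ (measurable_gaussianPDF 0 1) (by fun_prop)]
  congr 1
  ext y
  rw [Pi.mul_apply, gaussianPDF, gaussianPDF, ← ENNReal.ofReal_mul (gaussianPDFReal_nonneg 0 1 y)]
  congr 1
  rw [gaussianPDFReal, gaussianPDFReal, mul_assoc (√(2 * Real.pi * ((1 : ℝ≥0) : ℝ)))⁻¹,
    ← Real.exp_add]
  congr 2
  simp only [NNReal.coe_one]
  ring

/-- The standard Gaussian measure on `ℝⁿ`. -/
abbrev stdGaussian (n : ℕ) : Measure (Fin n → ℝ) := Measure.pi fun _ => gaussianReal 0 1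

/-- The density of `N(b, 1)` with respect to `N(0, 1)`. -/
def gaussDensity {n : ℕ} (b y : Fin n → ℝ) : ℝ := Real.exp (∑ i, (b i * y i - b i ^ 2 / 2))

theorem map_add_stdGaussian {n : ℕ} (b : Fin n → ℝ) :
    (stdGaussian n).map (fun w => b + w) =
      (stdGaussian n).withDensity fun y => ENNReal.ofReal (gaussDensity b y) := by
  have h1 : ∀ i : Fin n, (gaussianReal 0 1).map (fun x => b i + x) =
      (gaussianReal 0 1).withDensity
        fun y => ENNReal.ofReal (Real.exp (b i * y - b i ^ 2 / 2)) := by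
    intro i
    rw [gaussianReal_map_const_add, zero_add, gaussianReal_eq_withDensity]
  have hp : ∀ i : Fin n, IsProbabilityMeasure ((gaussianReal 0 1).map (fun x => b i + x)) :=
    fun i => Measure.isProbabilityMeasure_map (by fun_prop)
  have h2 := Measure.pi_map_pi (μ := fun _ : Fin n => gaussianReal 0 1)
    (f := fun (i : Fin n) (x : ℝ) => b i + x) fun i => by fun_prop
  have h3 : (stdGaussian n).map (fun w => b + w) =
      Measure.pi fun i => (gaussianReal 0 1).map (fun x => b i + x) := h2
  have hs : ∀ i : Fin n, SigmaFinite ((gaussianReal 0 1).withDensity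
      fun y => ENNReal.ofReal (Real.exp (b i * y - b i ^ 2 / 2))) := by
    intro i
    rw [← h1]
    infer_instance
  rw [h3]
  simp only [h1]
  rw [pi_withDensity _ _ fun i => by fun_prop]
  congr 1
  ext y
  rw [gaussDensity, Real.exp_sum, ENNReal.ofReal_prod_of_nonneg fun i _ => (Real.exp_pos _).le]

theorem measurable_gaussDensity (n : ℕ) :
    Measurable fun p : (Fin n → ℝ) × (Fin n → ℝ) => gaussDensity p.1 p.2 := by
  unfold gaussDensity
  fun_prop

theorem lintegral_add_stdGaussian {n : ℕ} (b : Fin n → ℝ) {g : (Fin n → ℝ) → ℝ≥0∞}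
    (hg : Measurable g) :
    ∫⁻ w, g (b + w) ∂stdGaussian n =
      ∫⁻ y, ENNReal.ofReal (gaussDensity b y) * g y ∂stdGaussian n := by
  rw [← lintegral_map (f := g) (g := fun w => b + w) hg (by fun_prop), map_add_stdGaussian,
    lintegral_withDensity_eq_lintegral_mul _ _ hg]
  · rfl
  · exact ((measurable_gaussDensity n).comp (f := fun y => (b, y)) (by fun_prop)).ennreal_ofReal

theorem lintegral_gaussDensity {n : ℕ} (b : Fin n → ℝ) :
    ∫⁻ y, ENNReal.ofReal (gaussDensity b y) ∂stdGaussian n = 1 := by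
  have h := lintegral_add_stdGaussian b (g := fun _ => 1) measurable_const
  simpa using h.symm

/-- Completing the square. The bound is free of the shift `b`, so it serves as the envelope `G` for
every input and side information. -/
theorem gaussDensity_le {n : ℕ} (b y : Fin n → ℝ) :
    gaussDensity b y ≤ Real.exp (∑ i, y i ^ 2 / 2) := by
  refine Real.exp_le_exp.mpr (Finset.sum_le_sum fun i _ => ?_)
  nlinarith [sq_nonneg (b i - y i)]

/-! ### The channel densities -/

@[fun_prop]
theorem measurable_bit : Measurable bit := measurable_of_finite _

/-- What the receiver knows of the channel state, `(A, H)`. -/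
abbrev SideInfo (n : ℕ) : Type := (Fin n → Bool) × (Fin n → Fin n → ℝ)

/-- The law of `(A, H)`. -/
abbrev sideLaw {n : ℕ} (α : Measure (Fin n → Bool)) (ν : Measure ℝ) : Measure (SideInfo n) :=
  α.prod (Measure.pi fun _ => Measure.pi fun _ => ν)

/-- The noiseless observation `A H x`. -/
def observed {n : ℕ} (z : SideInfo n) (x : Fin n → ℝ) : Fin n → ℝ :=
  (Matrix.diagonal (fun i => bit (z.1 i)) * Matrix.of z.2).mulVec x

theorem observed_apply {n : ℕ} (z : SideInfo n) (x : Fin n → ℝ) (i : Fin n) :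
    observed z x i = bit (z.1 i) * ∑ j, z.2 i j * x j := by
  simp [observed, Matrix.mulVec, dotProduct, Finset.mul_sum, mul_assoc]

theorem received_eq {n : ℕ} (u : Fin n → ℝ) (ω : State n) :
    received u ω = observed (ω.2.1, ω.2.2.1) (sparseVector ω.1 u) + ω.2.2.2 := rfl

theorem measurable_observed (n : ℕ) :
    Measurable fun p : SideInfo n × (Fin n → ℝ) => observed p.1 p.2 := by
  refine measurable_pi_lambda _ fun i => ?_
  simp only [observed_apply]
  fun_prop

theorem measurable_sparseVector (n : ℕ) :
    Measurable fun p : (Fin n → Bool) × (Fin n → ℝ) => sparseVector p.1 p.2 := by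
  unfold sparseVector
  fun_prop

theorem measurable_received (n : ℕ) :
    Measurable fun p : (Fin n → ℝ) × State n => received p.1 p.2 := by
  refine Measurable.add (f := fun p : (Fin n → ℝ) × State n =>
    observed (p.2.2.1, p.2.2.2.1) (sparseVector p.2.1 p.1)) ?_ (by fun_prop)
  refine (measurable_observed n).comp (f := fun p : (Fin n → ℝ) × State n =>
    ((p.2.2.1, p.2.2.2.1), sparseVector p.2.1 p.1)) (Measurable.prodMk (by fun_prop) ?_)
  exact (measurable_sparseVector n).comp (f := fun p : (Fin n → ℝ) × State n => (p.2.1, p.1))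
    (by fun_prop)

/-- The density of `Y` given `(A, H)` and `X = x`. -/
def densityX {n : ℕ} (z : SideInfo n) (x y : Fin n → ℝ) : ℝ := gaussDensity (observed z x) y

/-- The density of `Y` given `(A, H)` and `U = u`. -/
def densityU (f : ℝ → ℝ) {n : ℕ} (z : SideInfo n) (u y : Fin n → ℝ) : ℝ :=
  ∑ s : Fin n → Bool, patternProb f s * densityX z (sparseVector s u) y

theorem measurable_densityX (n : ℕ) :
    Measurable fun t : SideInfo n × (Fin n → ℝ) × (Fin n → ℝ) => densityX t.1 t.2.1 t.2.2 :=
  (measurable_gaussDensity n).comp (f := fun t : SideInfo n × (Fin n → ℝ) × (Fin n → ℝ) =>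
    (observed t.1 t.2.1, t.2.2)) (Measurable.prodMk ((measurable_observed n).comp
      (f := fun t : SideInfo n × (Fin n → ℝ) × (Fin n → ℝ) => (t.1, t.2.1)) (by fun_prop))
      (by fun_prop))

theorem densityX_pos {n : ℕ} (z : SideInfo n) (x y : Fin n → ℝ) : 0 < densityX z x y :=
  Real.exp_pos _

theorem measurable_densityX_sparse {n : ℕ} (s : Fin n → Bool) :
    Measurable fun t : SideInfo n × (Fin n → ℝ) × (Fin n → ℝ) =>
      densityX t.1 (sparseVector s t.2.1) t.2.2 :=
  (measurable_densityX n).comp (f := fun t : SideInfo n × (Fin n → ℝ) × (Fin n → ℝ) =>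
    (t.1, sparseVector s t.2.1, t.2.2)) (Measurable.prodMk (by fun_prop)
      (Measurable.prodMk ((measurable_sparseVector n).comp (f := fun t : SideInfo n ×
        (Fin n → ℝ) × (Fin n → ℝ) => (s, t.2.1)) (by fun_prop)) (by fun_prop)))

theorem measurable_densityU (f : ℝ → ℝ) (n : ℕ) :
    Measurable fun t : SideInfo n × (Fin n → ℝ) × (Fin n → ℝ) => densityU f t.1 t.2.1 t.2.2 :=
  Finset.measurable_fun_sum _ fun s _ => (measurable_densityX_sparse s).const_mul _

theorem densityU_pos (f : ℝ → ℝ) {n : ℕ} (z : SideInfo n) (u y : Fin n → ℝ) :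
    0 < densityU f z u y :=
  Finset.sum_pos (fun s _ => mul_pos (patternProb_pos f s) (densityX_pos _ _ _))
    Finset.univ_nonempty

theorem densityU_le (f : ℝ → ℝ) {n : ℕ} (z : SideInfo n) (u y : Fin n → ℝ) :
    densityU f z u y ≤ Real.exp (∑ i, y i ^ 2 / 2) :=
  calc densityU f z u y ≤ ∑ s : Fin n → Bool, patternProb f s * Real.exp (∑ i, y i ^ 2 / 2) :=
        Finset.sum_le_sum fun s _ => mul_le_mul_of_nonneg_left (gaussDensity_le _ _)
          (patternProb_pos f s).le
    _ = _ := by rw [← Finset.sum_mul, sum_patternProb, one_mul]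

theorem ofReal_densityU (f : ℝ → ℝ) {n : ℕ} (z : SideInfo n) (u y : Fin n → ℝ) :
    ENNReal.ofReal (densityU f z u y) = ∑ s : Fin n → Bool,
      ENNReal.ofReal (patternProb f s) * ENNReal.ofReal (densityX z (sparseVector s u) y) := by
  rw [densityU, ENNReal.ofReal_sum_of_nonneg fun s _ =>
    (mul_pos (patternProb_pos f s) (densityX_pos _ _ _)).le]
  exact Finset.sum_congr rfl fun s _ => ENNReal.ofReal_mul (patternProb_pos f s).le

theorem lintegral_densityU (f : ℝ → ℝ) {n : ℕ} (z : SideInfo n) (u : Fin n → ℝ) :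
    ∫⁻ y, ENNReal.ofReal (densityU f z u y) ∂stdGaussian n = 1 := by
  simp only [ofReal_densityU]
  have hm : ∀ s : Fin n → Bool,
      Measurable fun y => ENNReal.ofReal (densityX z (sparseVector s u) y) := fun s =>
    ((measurable_densityX n).comp (f := fun y => (z, sparseVector s u, y))
      (by fun_prop)).ennreal_ofReal
  rw [lintegral_finsetSum _ fun s _ => (hm s).const_mul _]
  simp only [lintegral_const_mul _ (hm _)]
  simp only [densityX, lintegral_gaussDensity, mul_one]
  rw [← ENNReal.ofReal_sum_of_nonneg fun s _ => (patternProb_pos f s).le, sum_patternProb,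
    ENNReal.ofReal_one]

theorem lintegral_patternPMF (f : ℝ → ℝ) {n : ℕ} (g : (Fin n → Bool) → ℝ≥0∞) :
    ∫⁻ s, g s ∂(patternPMF f n).toMeasure = ∑ s, ENNReal.ofReal (patternProb f s) * g s := by
  rw [lintegral_fintype]
  refine Finset.sum_congr rfl fun s _ => ?_
  rw [PMF.toMeasure_apply_singleton _ _ (MeasurableSet.singleton s), patternPMF_apply, mul_comm]

variable {n : ℕ} (σ : ℝ≥0) (f : ℝ → ℝ)

theorem lintegral_stateLaw (α : Measure (Fin n → Bool)) (ν : Measure ℝ)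
    [SFinite α] [IsProbabilityMeasure ν] (u : Fin n → ℝ)
    (g : (Fin n → Bool) × SideInfo n × (Fin n → ℝ) → ℝ≥0∞) (hg : Measurable g) :
    ∫⁻ ω, g (ω.1, (ω.2.1, ω.2.2.1), received u ω) ∂stateLaw f α ν =
      ∑ s, ENNReal.ofReal (patternProb f s) * ∫⁻ z, ∫⁻ y,
        ENNReal.ofReal (densityX z (sparseVector s u) y) * g (s, z, y)
          ∂stdGaussian n ∂sideLaw α ν := by
  have hm : Measurable fun ω : State n => g (ω.1, (ω.2.1, ω.2.2.1), received u ω) :=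
    hg.comp (Measurable.prodMk (by fun_prop) (Measurable.prodMk (by fun_prop)
      ((measurable_received n).comp (f := fun ω : State n => (u, ω)) (by fun_prop))))
  rw [stateLaw, lintegral_prod _ hm.aemeasurable, lintegral_patternPMF]
  refine Finset.sum_congr rfl fun s _ => ?_
  congr 1
  have hm2 : Measurable fun p : SideInfo n × (Fin n → ℝ) =>
      ENNReal.ofReal (densityX p.1 (sparseVector s u) p.2) * g (s, p.1, p.2) := by
    refine Measurable.mul ?_ (hg.comp (by fun_prop))
    exact ((measurable_densityX n).comp (f := fun p : SideInfo n × (Fin n → ℝ) =>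
      (p.1, sparseVector s u, p.2)) (by fun_prop)).ennreal_ofReal
  rw [lintegral_prod (μ := α) _ (hm2.lintegral_prod_right').aemeasurable]
  refine (lintegral_prod _ (hm.comp (f := fun t => (s, t)) (by fun_prop)).aemeasurable).trans ?_
  refine lintegral_congr fun a => ?_
  refine (lintegral_prod _ (hm.comp (f := fun t => (s, a, t)) (by fun_prop)).aemeasurable).trans ?_
  refine lintegral_congr fun h => ?_
  exact lintegral_add_stdGaussian (observed (a, h) (sparseVector s u))
    (g := fun y => g (s, (a, h), y)) (hg.comp (by fun_prop))

/-- The law of the information-carrying vector `U`. -/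
abbrev inputLaw (σ : ℝ≥0) (n : ℕ) : Measure (Fin n → ℝ) := Measure.pi fun _ => gaussianReal 0 (σ ^ 2)

/-- The law of `X = S ⊙ U`. -/
def sparseLaw (σ : ℝ≥0) (f : ℝ → ℝ) (n : ℕ) : Measure (Fin n → ℝ) :=
  ((inputLaw σ n).prod (patternPMF f n).toMeasure).map fun p => sparseVector p.2 p.1

theorem measurable_sparseVector_swap (n : ℕ) :
    Measurable fun p : (Fin n → ℝ) × (Fin n → Bool) => sparseVector p.2 p.1 :=
  (measurable_sparseVector n).comp measurable_swap

instance (σ : ℝ≥0) (f : ℝ → ℝ) (n : ℕ) : IsProbabilityMeasure (sparseLaw σ f n) :=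
  Measure.isProbabilityMeasure_map (measurable_sparseVector_swap n).aemeasurable

theorem lintegral_sparseLaw (g : (Fin n → ℝ) → ℝ≥0∞) (hg : Measurable g) :
    ∫⁻ x, g x ∂sparseLaw σ f n = ∫⁻ u, ∑ s, ENNReal.ofReal (patternProb f s) *
      g (sparseVector s u) ∂inputLaw σ n := by
  have hm := measurable_sparseVector_swap n
  rw [sparseLaw, lintegral_map hg hm]
  refine (lintegral_prod _ (hg.comp hm).aemeasurable).trans ?_
  exact lintegral_congr fun u => lintegral_patternPMF f _

variable (α : Measure (Fin n → Bool)) (ν : Measure ℝ)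
    [IsProbabilityMeasure α] [IsProbabilityMeasure ν]

/-- Fubini brings the side information to the outermost integral, the order required by
`HasChannelDensity`. -/
theorem lintegral_modelLaw (g : (Fin n → ℝ) × (Fin n → Bool) × SideInfo n × (Fin n → ℝ) → ℝ≥0∞)
    (hg : Measurable g) :
    ∫⁻ ω, g (ω.1, ω.2.1, (ω.2.2.1, ω.2.2.2.1), received ω.1 ω.2) ∂modelLaw σ f α ν =
      ∫⁻ z, ∫⁻ u, ∑ s, ENNReal.ofReal (patternProb f s) * ∫⁻ y,
        ENNReal.ofReal (densityX z (sparseVector s u) y) * g (u, s, z, y)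
          ∂stdGaussian n ∂inputLaw σ n ∂sideLaw α ν := by
  have hm : Measurable fun ω : (Fin n → ℝ) × State n =>
      g (ω.1, ω.2.1, (ω.2.2.1, ω.2.2.2.1), received ω.1 ω.2) :=
    hg.comp (Measurable.prodMk (by fun_prop) (Measurable.prodMk (by fun_prop)
      (Measurable.prodMk (by fun_prop) (measurable_received n))))
  have hF : ∀ s : Fin n → Bool, Measurable fun t : (SideInfo n × (Fin n → ℝ)) × (Fin n → ℝ) =>
      ENNReal.ofReal (densityX t.1.1 (sparseVector s t.1.2) t.2) * g (t.1.2, s, t.1.1, t.2) := by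
    intro s
    refine Measurable.mul ?_ (hg.comp (by fun_prop))
    exact ((measurable_densityX_sparse s).comp (f := fun t : (SideInfo n × (Fin n → ℝ)) ×
      (Fin n → ℝ) => (t.1.1, t.1.2, t.2)) (by fun_prop)).ennreal_ofReal
  have hF2 : ∀ s : Fin n → Bool, Measurable fun t : SideInfo n × (Fin n → ℝ) => ∫⁻ y,
      ENNReal.ofReal (densityX t.1 (sparseVector s t.2) y) * g (t.2, s, t.1, y) ∂stdGaussian n :=
    fun s => (hF s).lintegral_prod_right'
  rw [modelLaw, lintegral_prod _ hm.aemeasurable,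
    lintegral_lintegral_swap (μ := sideLaw α ν) (Finset.measurable_fun_sum _ fun s _ =>
      (hF2 s).const_mul _).aemeasurable]
  refine lintegral_congr fun u => ?_
  rw [lintegral_stateLaw f α ν u (fun t => g (u, t)) (hg.comp (by fun_prop))]
  refine Eq.trans ?_ (lintegral_finsetSum _ fun s _ =>
      ((hF2 s).comp (f := fun z => (z, u)) (by fun_prop)).const_mul _).symm
  refine Finset.sum_congr rfl fun s _ => ?_
  exact (lintegral_const_mul _ ((hF2 s).comp (f := fun z => (z, u)) (by fun_prop))).symm

theorem hasChannelDensity_densityX :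
    HasChannelDensity densityX (fun y => ∑ i, y i ^ 2 / 2) (sideLaw α ν) (sparseLaw σ f n)
      (stdGaussian n) (modelLaw σ f α ν) (fun ω => (ω.2.2.1, ω.2.2.2.1))
      (fun ω => sparseVector ω.2.1 ω.1) (fun ω => received ω.1 ω.2) where
  measurable_Z := by fun_prop
  measurable_V := (measurable_sparseVector n).comp
    (f := fun ω : (Fin n → ℝ) × State n => (ω.2.1, ω.1)) (by fun_prop)
  measurable_Y := measurable_received n
  measurable := measurable_densityX n
  pos := densityX_pos
  le_exp z x y := gaussDensity_le _ _
  lintegral_eq_one z x := lintegral_gaussDensity _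
  lintegral_comp g hg := by
    have hmg : Measurable fun t : (Fin n → ℝ) × (Fin n → Bool) × SideInfo n × (Fin n → ℝ) =>
        g (t.2.2.1, sparseVector t.2.1 t.1, t.2.2.2) :=
      hg.comp (Measurable.prodMk (by fun_prop) (Measurable.prodMk ((measurable_sparseVector n).comp
        (f := fun t : (Fin n → ℝ) × (Fin n → Bool) × SideInfo n × (Fin n → ℝ) => (t.2.1, t.1))
        (by fun_prop)) (by fun_prop)))
    rw [lintegral_modelLaw σ f α ν _ hmg]
    refine lintegral_congr fun z => ?_
    rw [lintegral_sparseLaw]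
    refine Measurable.lintegral_prod_right' (ν := stdGaussian n) (f := fun t : (Fin n → ℝ) ×
      (Fin n → ℝ) => ENNReal.ofReal (densityX z t.1 t.2) * g (z, t.1, t.2)) ?_
    exact ((measurable_densityX n).comp (f := fun t : (Fin n → ℝ) × (Fin n → ℝ) =>
      (z, t.1, t.2)) (by fun_prop)).ennreal_ofReal.mul (hg.comp (by fun_prop))

theorem hasChannelDensity_densityU :
    HasChannelDensity (densityU f) (fun y => ∑ i, y i ^ 2 / 2) (sideLaw α ν) (inputLaw σ n)
      (stdGaussian n) (modelLaw σ f α ν) (fun ω => (ω.2.2.1, ω.2.2.2.1))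
      (fun ω => ω.1) (fun ω => received ω.1 ω.2) where
  measurable_Z := by fun_prop
  measurable_V := by fun_prop
  measurable_Y := measurable_received n
  measurable := measurable_densityU f n
  pos := densityU_pos f
  le_exp := densityU_le f
  lintegral_eq_one := lintegral_densityU f
  lintegral_comp g hg := by
    have hmg : Measurable fun t : (Fin n → ℝ) × (Fin n → Bool) × SideInfo n × (Fin n → ℝ) =>
        g (t.2.2.1, t.1, t.2.2.2) := hg.comp (by fun_prop)
    rw [lintegral_modelLaw σ f α ν _ hmg]
    refine lintegral_congr fun z => lintegral_congr fun u => ?_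
    have hm : ∀ s : Fin n → Bool, Measurable fun y =>
        ENNReal.ofReal (densityX z (sparseVector s u) y) * g (z, u, y) := fun s =>
      ((measurable_densityX n).comp (f := fun y => (z, sparseVector s u, y))
        (by fun_prop)).ennreal_ofReal.mul (hg.comp (by fun_prop))
    simp only [ofReal_densityU, Finset.sum_mul, mul_assoc]
    rw [lintegral_finsetSum _ fun s _ => (hm s).const_mul _]
    exact Finset.sum_congr rfl fun s _ => (lintegral_const_mul _ (hm s)).symm

/-- Drawing `X` amounts to drawing `u` and `s`, and averaging over `s` turns `densityX` into
`densityU`. -/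
theorem outDensity_densityX (z : SideInfo n) (y : Fin n → ℝ) :
    outDensity densityX (sparseLaw σ f n) z y = outDensity (densityU f) (inputLaw σ n) z y := by
  rw [outDensity, outDensity, lintegral_sparseLaw]
  · simp only [ofReal_densityU]
  · exact ((measurable_densityX n).comp (f := fun x => (z, x, y)) (by fun_prop)).ennreal_ofReal

/-- The mixture `densityU` is at least its term for `s`, and the denominators agree. This is the
pointwise form of the entropy penalty. -/
theorem infoDensity_densityX_le (z : SideInfo n) (s : Fin n → Bool) (u y : Fin n → ℝ) :
    infoDensity densityX (sparseLaw σ f n) z (sparseVector s u) y ≤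
      infoDensity (densityU f) (inputLaw σ n) z u y + -Real.log (patternProb f s) := by
  -- Positivity does not involve the laws of `A` and `H`, so point masses serve as placeholders.
  have hq : 0 < outDensity (densityU f) (inputLaw σ n) z y :=
    (hasChannelDensity_densityU σ f (Measure.dirac fun _ => false)
      (Measure.dirac 0)).outDensity_pos z y
  have h1 : patternProb f s * densityX z (sparseVector s u) y ≤ densityU f z u y :=
    Finset.single_le_sum (f := fun s => patternProb f s * densityX z (sparseVector s u) y)
      (fun s _ => (mul_pos (patternProb_pos f s) (densityX_pos _ _ _)).le) (Finset.mem_univ s)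
  have h2 := Real.log_le_log (mul_pos (patternProb_pos f s) (densityX_pos _ _ _)) h1
  rw [Real.log_mul (patternProb_pos f s).ne' (densityX_pos _ _ _).ne'] at h2
  rw [infoDensity, infoDensity, outDensity_densityX, Real.log_div (densityX_pos _ _ _).ne' hq.ne',
    Real.log_div (densityU_pos _ _ _ _).ne' hq.ne']
  linarith

end SparseCoding

namespace SparseCoding

/-! ### The output power and the information inequalities -/

theorem lintegral_sq_eq_variance {Ω : Type*} [MeasurableSpace Ω] {μ : Measure Ω}
    [IsProbabilityMeasure μ] {X : Ω → ℝ} (hX : MemLp X 2 μ) (h0 : ∫ ω, X ω ∂μ = 0) :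
    ∫⁻ ω, ENNReal.ofReal (X ω ^ 2) ∂μ = ENNReal.ofReal (variance X μ) := by
  rw [hX.ofReal_variance_eq, evariance_eq_lintegral_ofReal, h0]
  simp

theorem lintegral_sq_gaussianReal (v : ℝ≥0) :
    ∫⁻ x, ENNReal.ofReal (x ^ 2) ∂gaussianReal 0 v = v := by
  have h := lintegral_sq_eq_variance (μ := gaussianReal 0 v) (X := id)
    (memLp_id_gaussianReal 2) integral_id_gaussianReal
  rw [variance_id_gaussianReal, ENNReal.ofReal_coe_nnreal] at h
  exact h

/-- The linear form is centred, so its second moment is its variance, which is additive over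
independent coordinates. -/
theorem lintegral_sq_sum_mul {n : ℕ} {ν : Measure ℝ} [IsProbabilityMeasure ν] {v : ℝ}
    (h2 : MemLp id 2 ν) (h0 : ∫ x, x ∂ν = 0) (hv : variance id ν = v) (x : Fin n → ℝ) :
    ∫⁻ h, ENNReal.ofReal ((∑ j, h j * x j) ^ 2) ∂(Measure.pi fun _ : Fin n => ν) =
      ENNReal.ofReal (∑ j, v * x j ^ 2) := by
  have hm : ∀ j, MemLp (fun h : ℝ => h * x j) 2 ν := fun j => h2.mul_const (x j)
  have hm' : ∀ j, MemLp (fun h : Fin n → ℝ => h j * x j) 2 (Measure.pi fun _ : Fin n => ν) :=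
    fun j => (hm j).comp_measurePreserving (measurePreserving_eval (fun _ : Fin n => ν) j)
  have hvar := variance_sum_pi (μ := fun _ : Fin n => ν) (X := fun j h => h * x j) hm
  have hvar2 : ∀ j, variance (fun h : ℝ => h * x j) ν = v * x j ^ 2 := fun j => by
    rw [variance_mul_const, ← hv]; rfl
  simp only [hvar2] at hvar
  rw [← hvar, ← lintegral_sq_eq_variance]
  · simp
  · exact memLp_finsetSum' _ fun j _ => hm' j
  · simp only [Finset.sum_apply]
    rw [integral_finsetSum _ fun j _ => (hm' j).integrable one_le_two]
    refine Finset.sum_eq_zero fun j _ => ?_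
    have := (measurePreserving_eval (fun _ : Fin n => ν) j).map_eq
    rw [← integral_map (φ := fun h : Fin n → ℝ => h j) (f := fun y => y * x j)
      (measurable_pi_apply j).aemeasurable (by fun_prop), this, integral_mul_const, h0, zero_mul]

variable {n : ℕ} (σ : ℝ≥0) (f : ℝ → ℝ) (α : Measure (Fin n → Bool)) (ν : Measure ℝ)
    [IsProbabilityMeasure α] [IsProbabilityMeasure ν]

theorem bit_sq_le (b : Bool) : bit b ^ 2 ≤ 1 := by
  cases b <;> simp [bit]

theorem lintegral_sq_observed_le
    (hν : MemLp id 2 ν ∧ ∫ x, x ∂ν = 0 ∧ variance id ν = 1 / (n : ℝ)) (u : Fin n → ℝ) (i : Fin n) :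
    ∫⁻ ω : State n, ENNReal.ofReal ((∑ j, ω.2.2.1 i j * (bit (ω.1 j) * u j)) ^ 2) ∂stateLaw f α ν ≤
      ENNReal.ofReal (∑ j, 1 / (n : ℝ) * u j ^ 2) := by
  have hinner : ∀ s : Fin n → Bool, ∫⁻ t : (Fin n → Bool) × (Fin n → Fin n → ℝ) × (Fin n → ℝ),
      ENNReal.ofReal ((∑ j, t.2.1 i j * (bit (s j) * u j)) ^ 2) ∂(α.prod
        ((Measure.pi fun _ => Measure.pi fun _ => ν).prod (stdGaussian n))) ≤
      ENNReal.ofReal (∑ j, 1 / (n : ℝ) * u j ^ 2) := by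
    intro s
    have hp : MeasurePreserving (fun t : (Fin n → Bool) × (Fin n → Fin n → ℝ) × (Fin n → ℝ) =>
        t.2.1 i) (α.prod ((Measure.pi fun _ => Measure.pi fun _ => ν).prod (stdGaussian n)))
        (Measure.pi fun _ => ν) :=
      (measurePreserving_eval (fun _ : Fin n => Measure.pi fun _ : Fin n => ν) i).comp
        (measurePreserving_fst.comp measurePreserving_snd)
    have h1 := hp.lintegral_comp (f := fun h : Fin n → ℝ =>
      ENNReal.ofReal ((∑ j, h j * (bit (s j) * u j)) ^ 2)) (by fun_prop)
    rw [h1, lintegral_sq_sum_mul hν.1 hν.2.1 hν.2.2]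
    refine ENNReal.ofReal_le_ofReal (Finset.sum_le_sum fun j _ => ?_)
    refine mul_le_mul_of_nonneg_left ?_ (by positivity)
    rw [mul_pow]
    exact mul_le_of_le_one_left (sq_nonneg _) (bit_sq_le _)
  rw [stateLaw, lintegral_prod _ (by fun_prop)]
  calc _ ≤ ∫⁻ _, ENNReal.ofReal (∑ j, 1 / (n : ℝ) * u j ^ 2) ∂(patternPMF f n).toMeasure :=
        lintegral_mono fun s => hinner s
    _ = _ := by simp

theorem lintegral_sq_received_le
    (hν : MemLp id 2 ν ∧ ∫ x, x ∂ν = 0 ∧ variance id ν = 1 / (n : ℝ)) (i : Fin n) :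
    ∫⁻ ω, ENNReal.ofReal (received ω.1 ω.2 i ^ 2 / 2) ∂modelLaw σ f α ν ≤
      ENNReal.ofReal (σ ^ 2 + 1) := by
  have hn : (n : ℝ) ≠ 0 := by
    have := i.pos
    positivity
  -- From `(c + w)² / 2 ≤ c² + w²`; the mask `A` can only decrease the signal part.
  have hpt : ∀ ω : (Fin n → ℝ) × State n, ENNReal.ofReal (received ω.1 ω.2 i ^ 2 / 2) ≤
      ENNReal.ofReal ((∑ j, ω.2.2.2.1 i j * (bit (ω.2.1 j) * ω.1 j)) ^ 2) +
        ENNReal.ofReal (ω.2.2.2.2 i ^ 2) := by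
    intro ω
    rw [← ENNReal.ofReal_add (sq_nonneg _) (sq_nonneg _)]
    refine ENNReal.ofReal_le_ofReal ?_
    rw [received_eq, Pi.add_apply, observed_apply]
    simp only [sparseVector]
    set c := ∑ j, ω.2.2.2.1 i j * (bit (ω.2.1 j) * ω.1 j)
    set w := ω.2.2.2.2 i
    have h1 : (bit (ω.2.2.1 i) * c) ^ 2 ≤ c ^ 2 := by
      rw [mul_pow]
      exact mul_le_of_le_one_left (sq_nonneg _) (bit_sq_le _)
    nlinarith [sq_nonneg (bit (ω.2.2.1 i) * c - w)]
  have hu : ∀ j : Fin n, ∫⁻ u, ENNReal.ofReal (u j ^ 2) ∂inputLaw σ n = (σ ^ 2 : ℝ≥0) := by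
    intro j
    rw [← lintegral_sq_gaussianReal]
    exact (measurePreserving_eval (fun _ : Fin n => gaussianReal 0 (σ ^ 2)) j).lintegral_comp
      (f := fun x : ℝ => ENNReal.ofReal (x ^ 2)) (by fun_prop)
  have hw : ∫⁻ ω : (Fin n → ℝ) × State n, ENNReal.ofReal (ω.2.2.2.2 i ^ 2) ∂modelLaw σ f α ν =
      1 := by
    have hp : MeasurePreserving (fun ω : (Fin n → ℝ) × State n => ω.2.2.2.2 i)
        (modelLaw σ f α ν) (gaussianReal 0 1) :=
      (measurePreserving_eval (fun _ : Fin n => gaussianReal 0 1) i).comp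
        (measurePreserving_snd.comp (measurePreserving_snd.comp
          (measurePreserving_snd.comp measurePreserving_snd)))
    rw [hp.lintegral_comp (f := fun x : ℝ => ENNReal.ofReal (x ^ 2)) (by fun_prop),
      lintegral_sq_gaussianReal, ENNReal.coe_one]
  have hc : ∫⁻ ω : (Fin n → ℝ) × State n,
      ENNReal.ofReal ((∑ j, ω.2.2.2.1 i j * (bit (ω.2.1 j) * ω.1 j)) ^ 2) ∂modelLaw σ f α ν ≤
      ENNReal.ofReal (σ ^ 2) := by
    rw [modelLaw, lintegral_prod _ (by fun_prop)]
    calc _ ≤ ∫⁻ u, ENNReal.ofReal (∑ j, 1 / (n : ℝ) * u j ^ 2) ∂inputLaw σ n :=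
          lintegral_mono fun u => lintegral_sq_observed_le f α ν hν u i
      _ = ∑ j : Fin n, ENNReal.ofReal (1 / (n : ℝ)) * ∫⁻ u, ENNReal.ofReal (u j ^ 2)
            ∂inputLaw σ n := by
          simp only [ENNReal.ofReal_sum_of_nonneg (fun j _ => mul_nonneg
            (by positivity : (0 : ℝ) ≤ 1 / (n : ℝ)) (sq_nonneg _)),
            ENNReal.ofReal_mul (by positivity : (0 : ℝ) ≤ 1 / (n : ℝ))]
          rw [lintegral_finsetSum _ fun j _ => by fun_prop]
          exact Finset.sum_congr rfl fun j _ => lintegral_const_mul _ (by fun_prop)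
      _ = ENNReal.ofReal (σ ^ 2) := by
          have h2 : ((σ ^ 2 : ℝ≥0) : ℝ≥0∞) = ENNReal.ofReal ((σ : ℝ) ^ 2) := by
            rw [← ENNReal.ofReal_coe_nnreal, NNReal.coe_pow]
          simp only [hu]
          rw [Finset.sum_const, Finset.card_univ, Fintype.card_fin, nsmul_eq_mul, h2,
            ← ENNReal.ofReal_mul (by positivity), ← ENNReal.ofReal_natCast,
            ← ENNReal.ofReal_mul (by positivity)]
          congr 1
          field_simp
  calc _ ≤ ∫⁻ ω : (Fin n → ℝ) × State n,
        (ENNReal.ofReal ((∑ j, ω.2.2.2.1 i j * (bit (ω.2.1 j) * ω.1 j)) ^ 2) +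
          ENNReal.ofReal (ω.2.2.2.2 i ^ 2)) ∂modelLaw σ f α ν := lintegral_mono hpt
    _ ≤ ENNReal.ofReal (σ ^ 2) + 1 := by
        rw [lintegral_add_right _ (by fun_prop), hw]
        gcongr
    _ = _ := by rw [ENNReal.ofReal_add (by positivity) zero_le_one, ENNReal.ofReal_one]

theorem integrable_power
    (hν : 0 < n → MemLp id 2 ν ∧ ∫ x, x ∂ν = 0 ∧ variance id ν = 1 / (n : ℝ)) :
    Integrable (fun ω => ∑ i, received ω.1 ω.2 i ^ 2 / 2) (modelLaw σ f α ν) ∧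
      ∫ ω, ∑ i, received ω.1 ω.2 i ^ 2 / 2 ∂modelLaw σ f α ν ≤ n * ((σ : ℝ) ^ 2 + 1) := by
  have hmi : ∀ i, Measurable fun ω : (Fin n → ℝ) × State n => received ω.1 ω.2 i ^ 2 / 2 :=
    fun i => (((measurable_pi_apply i).comp (measurable_received n)).pow_const 2).div_const 2
  have hm : Measurable fun ω : (Fin n → ℝ) × State n => ∑ i, received ω.1 ω.2 i ^ 2 / 2 :=
    Finset.measurable_fun_sum _ fun i _ => hmi i
  have h0 : ∀ ω : (Fin n → ℝ) × State n, 0 ≤ ∑ i, received ω.1 ω.2 i ^ 2 / 2 :=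
    fun ω => Finset.sum_nonneg fun i _ => by positivity
  have hle : ∫⁻ ω, ENNReal.ofReal (∑ i, received ω.1 ω.2 i ^ 2 / 2) ∂modelLaw σ f α ν ≤
      ENNReal.ofReal (n * (σ ^ 2 + 1)) := by
    have hs : ∀ ω : (Fin n → ℝ) × State n, ENNReal.ofReal (∑ i, received ω.1 ω.2 i ^ 2 / 2) =
        ∑ i, ENNReal.ofReal (received ω.1 ω.2 i ^ 2 / 2) := fun ω =>
      ENNReal.ofReal_sum_of_nonneg fun i _ => by positivity
    simp only [hs]
    rw [lintegral_finsetSum _ fun i _ => (hmi i).ennreal_ofReal]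
    -- The moment hypothesis needs `0 < n`, which the index `i` supplies; for `n = 0` the sum is
    -- empty.
    calc _ ≤ ∑ i : Fin n, ENNReal.ofReal ((σ : ℝ) ^ 2 + 1) :=
          Finset.sum_le_sum fun i _ => lintegral_sq_received_le σ f α ν (hν i.pos) i
      _ = _ := by
          rw [Finset.sum_const, Finset.card_univ, Fintype.card_fin, nsmul_eq_mul,
            ENNReal.ofReal_mul (by positivity), ENNReal.ofReal_natCast]
  refine ⟨⟨hm.aestronglyMeasurable, ?_⟩, ?_⟩
  · rw [hasFiniteIntegral_iff_ofReal (ae_of_all _ h0)]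
    exact hle.trans_lt ENNReal.ofReal_lt_top
  · rw [integral_eq_lintegral_of_nonneg_ae (ae_of_all _ h0) hm.aestronglyMeasurable]
    exact ENNReal.toReal_le_of_le_ofReal (by positivity) hle

/-- The information density between `X` and `Y` along the model. -/
def modelInfoX (ω : (Fin n → ℝ) × State n) : ℝ :=
  infoDensity densityX (sparseLaw σ f n) (ω.2.2.1, ω.2.2.2.1) (sparseVector ω.2.1 ω.1)
    (received ω.1 ω.2)

/-- The information density between `U` and `Y` along the model. -/
def modelInfoU (ω : (Fin n → ℝ) × State n) : ℝ :=
  infoDensity (densityU f) (inputLaw σ n) (ω.2.2.1, ω.2.2.2.1) ω.1 (received ω.1 ω.2)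

theorem integrable_modelInfoX
    (hν : 0 < n → MemLp id 2 ν ∧ ∫ x, x ∂ν = 0 ∧ variance id ν = 1 / (n : ℝ)) :
    Integrable (modelInfoX σ f) (modelLaw σ f α ν) :=
  ((hasChannelDensity_densityX σ f α ν).integrable_infoDensity (integrable_power σ f α ν hν).1).1

theorem integrable_modelInfoU
    (hν : 0 < n → MemLp id 2 ν ∧ ∫ x, x ∂ν = 0 ∧ variance id ν = 1 / (n : ℝ)) :
    Integrable (modelInfoU σ f) (modelLaw σ f α ν) :=
  ((hasChannelDensity_densityU σ f α ν).integrable_infoDensity (integrable_power σ f α ν hν).1).1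

theorem infoX_eq
    (hν : 0 < n → MemLp id 2 ν ∧ ∫ x, x ∂ν = 0 ∧ variance id ν = 1 / (n : ℝ)) :
    infoX σ f α ν = ENNReal.ofReal (∫ ω, modelInfoX σ f ω ∂modelLaw σ f α ν) :=
  (hasChannelDensity_densityX σ f α ν).condMutualInfo_eq (integrable_power σ f α ν hν).1

theorem infoU_eq
    (hν : 0 < n → MemLp id 2 ν ∧ ∫ x, x ∂ν = 0 ∧ variance id ν = 1 / (n : ℝ)) :
    infoU σ f α ν = ENNReal.ofReal (∫ ω, modelInfoU σ f ω ∂modelLaw σ f α ν) :=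
  (hasChannelDensity_densityU σ f α ν).condMutualInfo_eq (integrable_power σ f α ν hν).1

theorem infoX_le
    (hν : 0 < n → MemLp id 2 ν ∧ ∫ x, x ∂ν = 0 ∧ variance id ν = 1 / (n : ℝ)) :
    infoX σ f α ν ≤ ENNReal.ofReal (n * (σ ^ 2 + 1)) := by
  rw [infoX_eq σ f α ν hν]
  exact ENNReal.ofReal_le_ofReal (((hasChannelDensity_densityX σ f α ν).integrable_infoDensity
    (integrable_power σ f α ν hν).1).2.trans (integrable_power σ f α ν hν).2)

/-- Ignorance of the pattern costs at most its entropy. -/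
theorem infoX_le_infoU_add
    (hν : 0 < n → MemLp id 2 ν ∧ ∫ x, x ∂ν = 0 ∧ variance id ν = 1 / (n : ℝ)) :
    infoX σ f α ν ≤ infoU σ f α ν + ENNReal.ofReal (entropy (patternPMF f n)) := by
  have hp : MeasurePreserving (fun ω : (Fin n → ℝ) × State n => ω.2.1) (modelLaw σ f α ν)
      (patternPMF f n).toMeasure := measurePreserving_fst.comp measurePreserving_snd
  have hφ : Integrable (fun s : Fin n → Bool => -Real.log (patternProb f s))
      (patternPMF f n).toMeasure := .of_finite
  have hlog : Integrable (fun ω : (Fin n → ℝ) × State n => -Real.log (patternProb f ω.2.1))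
      (modelLaw σ f α ν) := hp.integrable_comp_of_integrable hφ
  have hval : ∫ ω, -Real.log (patternProb f ω.2.1) ∂modelLaw σ f α ν =
      entropy (patternPMF f n) := by
    rw [← integral_map (φ := fun ω : (Fin n → ℝ) × State n => ω.2.1)
      (f := fun s => -Real.log (patternProb f s)) hp.measurable.aemeasurable
      (hp.map_eq ▸ hφ.aestronglyMeasurable), hp.map_eq, PMF.integral_eq_sum, entropy_patternPMF]
    simp [patternPMF_toReal]
  rw [infoX_eq σ f α ν hν, infoU_eq σ f α ν hν]
  refine le_trans (ENNReal.ofReal_le_ofReal ?_) ENNReal.ofReal_add_le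
  rw [← hval, ← integral_add (integrable_modelInfoU σ f α ν hν) hlog]
  exact integral_mono (integrable_modelInfoX σ f α ν hν)
    ((integrable_modelInfoU σ f α ν hν).add hlog) fun ω => infoDensity_densityX_le σ f _ _ _ _

end SparseCoding

namespace SparseCoding

/-! ### Limit theorems for finite product measures -/

section LimitTheorems

variable {E : Type*} [MeasurableSpace E] (m : Measure E) [IsProbabilityMeasure m]

/-- This places all block lengths `N` on one probability space, where the limit theorems for i.i.d.
sequences apply. -/
theorem map_infinitePi_fin (N : ℕ) :
    (Measure.infinitePi fun _ : ℕ => m).map (fun ω (t : Fin N) => ω t) =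
      Measure.pi fun _ : Fin N => m := by
  have h := (iIndepFun_infinitePi (P := fun _ : ℕ => m) (X := fun _ x => x)
    fun _ => measurable_id).precomp (g := fun t : Fin N => (t : ℕ)) Fin.val_injective
  have h2 := (iIndepFun_iff_map_fun_eq_pi_map fun t : Fin N =>
    (measurable_pi_apply (t : ℕ)).aemeasurable).1 h
  refine h2.trans ?_
  congr 1
  ext1 t
  exact Measure.infinitePi_map_eval (fun _ : ℕ => m) (t : ℕ)

theorem pi_fin_apply {N : ℕ} {s : Set (Fin N → E)} (hs : MeasurableSet s) :
    (Measure.pi fun _ : Fin N => m) s =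
      (Measure.infinitePi fun _ : ℕ => m) {ω | (fun t : Fin N => ω t) ∈ s} := by
  rw [← map_infinitePi_fin, Measure.map_apply (by fun_prop) hs]
  rfl

theorem identDistrib_infinitePi {g : E → ℝ} (hg : Measurable g) (k : ℕ) :
    IdentDistrib (fun ω : ℕ → E => g (ω k)) (fun ω => g (ω 0))
      (Measure.infinitePi fun _ : ℕ => m) (Measure.infinitePi fun _ : ℕ => m) := by
  have h : ∀ k : ℕ, (Measure.infinitePi fun _ : ℕ => m).map (fun ω => g (ω k)) = m.map g := by
    intro k
    have h1 := Measure.map_map (μ := Measure.infinitePi fun _ : ℕ => m) hg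
      (measurable_pi_apply (X := fun _ : ℕ => E) k)
    rw [Measure.infinitePi_map_eval (fun _ : ℕ => m) k] at h1
    exact h1.symm
  exact ⟨(hg.comp (measurable_pi_apply k)).aemeasurable,
    (hg.comp (measurable_pi_apply 0)).aemeasurable, by rw [h, h]⟩

/-- The weak law of large numbers, as a bound on a lower tail. -/
theorem tendsto_pi_sum_le {g : E → ℝ} (hg : Measurable g) (hint : Integrable g m) {c : ℝ}
    (hc : c < ∫ x, g x ∂m) :
    Tendsto (fun N : ℕ => (Measure.pi fun _ : Fin N => m) {w | ∑ t, g (w t) ≤ N * c}) atTop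
      (𝓝 0) := by
  set P := Measure.infinitePi fun _ : ℕ => m with hP
  have hmp : MeasurePreserving (fun ω : ℕ → E => ω 0) P m :=
    ⟨measurable_pi_apply 0, Measure.infinitePi_map_eval (fun _ : ℕ => m) 0⟩
  have hmean : ∫ ω, g (ω 0) ∂P = ∫ x, g x ∂m := by
    rw [← hmp.map_eq, integral_map hmp.measurable.aemeasurable hg.aestronglyMeasurable]
  have hind : iIndepFun (fun (k : ℕ) (ω : ℕ → E) => g (ω k)) P :=
    iIndepFun_infinitePi (P := fun _ : ℕ => m) (X := fun _ => g) fun _ => hg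
  have hslln := strong_law_ae_real (μ := P) (fun (k : ℕ) (ω : ℕ → E) => g (ω k))
    (hmp.integrable_comp_of_integrable hint) (fun i j hij => hind.indepFun hij)
    (identDistrib_infinitePi m hg)
  rw [hmean] at hslln
  have htm := tendstoInMeasure_of_tendsto_ae (μ := P) (fun N =>
    ((Finset.measurable_fun_sum (Finset.range N) fun k _ => by fun_prop).div_const
      (N : ℝ)).aestronglyMeasurable) hslln
  -- An average at most `c` deviates from the mean by at least the mean minus `c`.
  have hlim := htm (ENNReal.ofReal (∫ x, g x ∂m - c)) (ENNReal.ofReal_pos.mpr (sub_pos.mpr hc))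
  refine tendsto_of_tendsto_of_tendsto_of_le_of_le' tendsto_const_nhds hlim
    (Eventually.of_forall fun _ => zero_le) ?_
  filter_upwards [eventually_gt_atTop 0] with N hN
  have hN' : (0 : ℝ) < N := by exact_mod_cast hN
  rw [pi_fin_apply m (measurableSet_le (by fun_prop) (by fun_prop))]
  refine measure_mono fun ω hω => ?_
  simp only [Set.mem_ofPred_eq] at hω ⊢
  rw [← Finset.sum_range fun k => g (ω k)] at hω
  rw [edist_dist, Real.dist_eq]
  refine ENNReal.ofReal_le_ofReal ?_
  have : (∑ k ∈ Finset.range N, g (ω k)) / N ≤ c := by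
    rw [div_le_iff₀ hN']
    linarith
  rw [abs_sub_comm]
  exact le_trans (by linarith) (le_abs_self _)

/-- A sum of i.i.d. variables lies below its mean with probability bounded away from zero. -/
theorem exists_le_pi_sum_le_mean {g : E → ℝ} (hg : Measurable g) (hg2 : MemLp g 2 m) :
    ∃ κ : ℝ≥0∞, 0 < κ ∧ ∀ᶠ N : ℕ in atTop,
      κ ≤ (Measure.pi fun _ : Fin N => m) {w | ∑ t, g (w t) ≤ N * ∫ x, g x ∂m} := by
  set P := Measure.infinitePi fun _ : ℕ => m with hP
  have hmp : MeasurePreserving (fun ω : ℕ → E => ω 0) P m :=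
    ⟨measurable_pi_apply 0, Measure.infinitePi_map_eval (fun _ : ℕ => m) 0⟩
  have hmean : ∫ ω, g (ω 0) ∂P = ∫ x, g x ∂m := by
    rw [← hmp.map_eq, integral_map hmp.measurable.aemeasurable hg.aestronglyMeasurable]
  have hind : iIndepFun (fun (k : ℕ) (ω : ℕ → E) => g (ω k)) P :=
    iIndepFun_infinitePi (P := fun _ : ℕ => m) (X := fun _ => g) fun _ => hg
  have hid := identDistrib_infinitePi m hg
  have hL2 : MemLp (fun ω : ℕ → E => g (ω 0)) 2 P := hg2.comp_measurePreserving hmp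
  have hset : ∀ N : ℕ, (Measure.pi fun _ : Fin N => m) {w | ∑ t, g (w t) ≤ N * ∫ x, g x ∂m} =
      P {ω | ∑ k ∈ Finset.range N, g (ω k) ≤ N * ∫ x, g x ∂m} := by
    intro N
    rw [pi_fin_apply m (measurableSet_le (by fun_prop) (by fun_prop))]
    congr 1
    ext ω
    simp only [Set.mem_ofPred_eq]
    rw [Finset.sum_range fun k => g (ω k)]
  simp only [hset]
  -- Without variance the sum equals its mean almost surely. Otherwise the central limit theorem and
  -- the portmanteau bound on the open half-line `(-∞, 0)` apply; half of the Gaussian mass lies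
  -- strictly below the lower limit.
  by_cases hv : variance (fun ω : ℕ → E => g (ω 0)) P = 0
  · refine ⟨1, one_pos, Eventually.of_forall fun N => ?_⟩
    have hae : ∀ᵐ ω ∂P, ∀ k : ℕ, g (ω k) = ∫ x, g x ∂m := by
      refine ae_all_iff.2 fun k => ?_
      have h1 : variance (fun ω : ℕ → E => g (ω k)) P = 0 := by rw [(hid k).variance_eq, hv]
      have h2 := ae_eq_integral_of_variance_eq_zero ((hid k).memLp_iff.2 hL2) h1
      rw [(hid k).integral_eq, hmean] at h2
      exact h2
    have : P {ω | ∑ k ∈ Finset.range N, g (ω k) ≤ N * ∫ x, g x ∂m} = 1 := by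
      rw [prob_compl_eq_zero_iff₀ (measurableSet_le (by fun_prop) (by fun_prop)).nullMeasurableSet
        |>.symm]
      rw [← mem_ae_iff]
      filter_upwards [hae] with ω hω
      simp [hω]
    exact this.ge
  · set v := (variance (fun ω : ℕ → E => g (ω 0)) P).toNNReal with hvdef
    have hv0 : v ≠ 0 := by
      rw [hvdef, ne_eq, Real.toNNReal_eq_zero, not_le]
      exact lt_of_le_of_ne (variance_nonneg _ _) (Ne.symm hv)
    have hclt := tendstoInDistribution_inv_sqrt_mul_sum_sub (P := P)
      (X := fun (k : ℕ) (ω : ℕ → E) => g (ω k)) (Y := id) (P' := gaussianReal 0 v)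
      ⟨aemeasurable_id, Measure.map_id⟩ hL2 hind hid
    have hport := ProbabilityMeasure.le_liminf_measure_open_of_tendsto hclt.tendsto
      (isOpen_Iio (a := (0 : ℝ)))
    have hpos : 0 < gaussianReal 0 v (Set.Iio 0) := by
      rw [pos_iff_ne_zero]
      intro h0
      have := gaussianReal_absolutelyContinuous' 0 hv0 h0
      simp at this
    simp only [ProbabilityMeasure.coe_mk, Measure.map_id] at hport
    refine ⟨gaussianReal 0 v (Set.Iio 0) / 2, ENNReal.half_pos hpos.ne', ?_⟩
    have hlt : gaussianReal 0 v (Set.Iio 0) / 2 <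
        liminf (fun N : ℕ => P.map (fun ω : ℕ → E => (√(N : ℝ))⁻¹ *
          (∑ k ∈ Finset.range N, g (ω k) - N * ∫ ω, g (ω 0) ∂P)) (Set.Iio 0)) atTop :=
      lt_of_lt_of_le (ENNReal.half_lt_self hpos.ne' (measure_ne_top _ _)) hport
    filter_upwards [eventually_lt_of_lt_liminf hlt, eventually_gt_atTop 0] with N hN hN0
    refine hN.le.trans ?_
    rw [Measure.map_apply (by fun_prop) measurableSet_Iio]
    refine measure_mono fun ω hω => ?_
    simp only [Set.mem_preimage, Set.mem_Iio, hmean, Set.mem_ofPred_eq] at hω ⊢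
    have hs : 0 < (√(N : ℝ))⁻¹ := inv_pos.mpr (Real.sqrt_pos.mpr (by exact_mod_cast hN0))
    by_contra hcon
    push Not at hcon
    exact absurd (mul_nonneg hs.le (sub_nonneg.mpr hcon.le)) (not_le.mpr hω)

end LimitTheorems

/-! ### Maximal codes -/

section MaximalCode

variable {𝓧 Ω 𝓞 : Type*} [MeasurableSpace 𝓧] [MeasurableSpace Ω] [MeasurableSpace 𝓞]

/-- Feinstein's maximal code construction with the codewords restricted to a set `F`. -/
theorem exists_codewords (P : Measure 𝓧) [IsProbabilityMeasure P] (μ : Measure Ω)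
    [IsProbabilityMeasure μ] {out : 𝓧 → Ω → 𝓞} (hout : Measurable fun p : 𝓧 × Ω => out p.1 p.2)
    {B : 𝓧 → Set 𝓞} (hB : MeasurableSet {p : 𝓧 × 𝓞 | p.2 ∈ B p.1}) (F : Set 𝓧)
    (β ε : ℝ≥0∞) (hβ : ∀ x, (P.prod μ) {p | out p.1 p.2 ∈ B x} ≤ β) (M : ℕ)
    (h : M * β + (P.prod μ) {p | out p.1 p.2 ∉ B p.1} < ε * P F) :
    ∃ x : ℕ → 𝓧, ∀ j < M, x j ∈ F ∧
      μ {ω | ¬ (out (x j) ω ∈ B (x j) ∧ ∀ i < j, out (x j) ω ∉ B (x i))} ≤ ε := by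
  have hne : Nonempty 𝓧 := nonempty_of_isProbabilityMeasure P
  have hBx : ∀ x, MeasurableSet (B x) := fun x =>
    hB.preimage (f := fun o => (x, o)) (by fun_prop)
  suffices hm : ∀ m ≤ M, ∃ x : ℕ → 𝓧, ∀ j < m, x j ∈ F ∧
      μ {ω | ¬ (out (x j) ω ∈ B (x j) ∧ ∀ i < j, out (x j) ω ∉ B (x i))} ≤ ε from hm M le_rfl
  intro m
  induction m with
  | zero => exact fun _ => ⟨fun _ => hne.some, fun j hj => absurd hj (Nat.not_lt_zero j)⟩
  | succ m ih =>
    intro hmM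
    obtain ⟨x, hx⟩ := ih (Nat.le_of_succ_le hmM)
    -- If every `y ∈ F` failed with probability above `ε`, integration over `F` would bound `ε P(F)`
    -- by the probability of missing one's own set plus that of hitting one of the `m` earlier sets,
    -- against `h`.
    have hstep : ∃ y ∈ F, μ {ω | ¬ (out y ω ∈ B y ∧ ∀ i < m, out y ω ∉ B (x i))} ≤ ε := by
      by_contra hcon
      push Not at hcon
      have hm1 : MeasurableSet {p : 𝓧 × Ω | out p.1 p.2 ∉ B p.1} :=
        (hB.preimage (f := fun p : 𝓧 × Ω => (p.1, out p.1 p.2)) (by fun_prop)).compl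
      have hm2 : MeasurableSet {p : 𝓧 × Ω | ∃ i < m, out p.1 p.2 ∈ B (x i)} := by
        have : {p : 𝓧 × Ω | ∃ i < m, out p.1 p.2 ∈ B (x i)} =
            ⋃ i ∈ Finset.range m, {p : 𝓧 × Ω | out p.1 p.2 ∈ B (x i)} := by
          ext p; simp
        rw [this]
        exact Finset.measurableSet_biUnion _ fun i _ => (hBx _).preimage hout
      have hQ : (P.prod μ) {p | ∃ i < m, out p.1 p.2 ∈ B (x i)} ≤ m * β := by
        have : {p : 𝓧 × Ω | ∃ i < m, out p.1 p.2 ∈ B (x i)} =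
            ⋃ i ∈ Finset.range m, {p : 𝓧 × Ω | out p.1 p.2 ∈ B (x i)} := by
          ext p; simp
        rw [this]
        refine (measure_biUnion_finset_le _ _).trans ?_
        calc _ ≤ ∑ _i ∈ Finset.range m, β := Finset.sum_le_sum fun i _ => hβ _
          _ = m * β := by simp
      have hle : ε * P F ≤ (P.prod μ) {p | out p.1 p.2 ∉ B p.1} +
          (P.prod μ) {p | ∃ i < m, out p.1 p.2 ∈ B (x i)} := by
        rw [Measure.prod_apply hm1, Measure.prod_apply hm2,
          ← lintegral_add_left (measurable_measure_prodMk_left hm1)]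
        calc ε * P F = ∫⁻ _ in F, ε ∂P := by simp
          _ ≤ ∫⁻ y in F, (μ (Prod.mk y ⁻¹' {p : 𝓧 × Ω | out p.1 p.2 ∉ B p.1}) +
              μ (Prod.mk y ⁻¹' {p : 𝓧 × Ω | ∃ i < m, out p.1 p.2 ∈ B (x i)})) ∂P := by
            refine setLIntegral_mono ((measurable_measure_prodMk_left hm1).add
              (measurable_measure_prodMk_left hm2)) fun y hy => ?_
            refine (hcon y hy).le.trans (le_trans (measure_mono fun ω hω => ?_)
              (measure_union_le _ _))
            simp only [Set.mem_ofPred_eq, Set.mem_union, Set.mem_preimage] at hω ⊢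
            by_contra hc
            push Not at hc
            exact (hω hc.1).elim fun i hi => hc.2 i hi.1 hi.2
          _ ≤ _ := setLIntegral_le_lintegral _ _
      refine absurd h (not_lt.mpr (hle.trans ?_))
      rw [add_comm]
      gcongr
      refine hQ.trans ?_
      gcongr
      omega
    obtain ⟨y, hyF, hy⟩ := hstep
    refine ⟨Function.update x m y, fun j hj => ?_⟩
    have hlt : ∀ i < m, Function.update x m y i = x i := fun i hi =>
      Function.update_of_ne hi.ne _ _
    rcases Nat.lt_succ_iff_lt_or_eq.mp hj with hj' | rfl
    · rw [hlt j hj']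
      have : ∀ ω, (∀ i < j, out (x j) ω ∉ B (Function.update x m y i)) ↔
          ∀ i < j, out (x j) ω ∉ B (x i) := fun ω =>
        forall₂_congr fun i hi => by rw [hlt i (hi.trans hj')]
      simp only [this]
      exact hx j hj'
    · rw [Function.update_self]
      have : ∀ ω, (∀ i < j, out y ω ∉ B (Function.update x j y i)) ↔
          ∀ i < j, out y ω ∉ B (x i) := fun ω =>
        forall₂_congr fun i hi => by rw [hlt i hi]
      simp only [this]
      exact ⟨hyF, hy⟩

/-- The decoder that chooses the first matching set. -/
theorem exists_decoder (B : ℕ → Set 𝓞) (hB : ∀ k, MeasurableSet (B k)) {M : ℕ} (hM : 0 < M) :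
    ∃ dec : 𝓞 → Fin M, Measurable dec ∧
      ∀ (j : Fin M) (o : 𝓞), o ∈ B j → (∀ i < (j : ℕ), o ∉ B i) → dec o = j := by
  classical
  -- The second alternative stops the search at `M - 1`, the default answer for outputs in none of
  -- the sets.
  have hex : ∀ o : 𝓞, ∃ k, o ∈ B k ∨ M ≤ k + 1 := fun o => ⟨M, Or.inr (Nat.le_succ M)⟩
  have hfind : Measurable fun o => Nat.find (hex o) :=
    measurable_find hex fun k => (hB k).union (MeasurableSet.const (M ≤ k + 1))
  refine ⟨fun o => ⟨min (Nat.find (hex o)) (M - 1), by omega⟩, ?_, fun j o hj hlt => ?_⟩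
  · exact (measurable_from_nat (f := fun k : ℕ => (⟨min k (M - 1), by omega⟩ : Fin M))).comp hfind
  · have : Nat.find (hex o) = j := by
      rw [Nat.find_eq_iff]
      refine ⟨Or.inl hj, fun k hk => ?_⟩
      rintro (h | h)
      · exact hlt k hk h
      · have := j.isLt
        omega
    ext
    simp only [this]
    have := j.isLt
    omega

end MaximalCode

/-! ### The coding theorem -/

section CodingTheorem

variable {𝓧 Ω 𝓞 : Type*} [MeasurableSpace 𝓧] [MeasurableSpace Ω] [MeasurableSpace 𝓞]

theorem prod_pi_apply (P : Measure 𝓧) [IsProbabilityMeasure P] (μ : Measure Ω)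
    [IsProbabilityMeasure μ] {N : ℕ} {s : Set ((Fin N → 𝓧) × (Fin N → Ω))} (hs : MeasurableSet s) :
    ((Measure.pi fun _ : Fin N => P).prod (Measure.pi fun _ : Fin N => μ)) s =
      (Measure.pi fun _ : Fin N => P.prod μ) {w | (fun t => (w t).1, fun t => (w t).2) ∈ s} := by
  rw [← (measurePreserving_arrowProdEquivProdArrow 𝓧 Ω (Fin N) (fun _ => P)
    fun _ => μ).measure_preimage hs.nullMeasurableSet]
  rfl

/-- Channel coding with a cost constraint: every rate below the mean information density is
achieved with codewords whose total cost is at most its mean. -/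
theorem eventually_exists_code (P : Measure 𝓧) [IsProbabilityMeasure P] (μ : Measure Ω)
    [IsProbabilityMeasure μ] {out : 𝓧 → Ω → 𝓞} (hout : Measurable fun p : 𝓧 × Ω => out p.1 p.2)
    {ι : 𝓧 → 𝓞 → ℝ} (hι : Measurable fun p : 𝓧 × 𝓞 => ι p.1 p.2)
    (hι1 : ∀ x, ∫⁻ w, ENNReal.ofReal (Real.exp (ι x (out w.1 w.2))) ∂(P.prod μ) ≤ 1)
    (hint : Integrable (fun w : 𝓧 × Ω => ι w.1 (out w.1 w.2)) (P.prod μ))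
    {ρ : 𝓧 → ℝ} (hρ : Measurable ρ) (hρ2 : MemLp ρ 2 P) {r : ℝ} (hr0 : 0 ≤ r)
    (hr : r < ∫ w, ι w.1 (out w.1 w.2) ∂(P.prod μ)) {ε : ℝ≥0∞} (hε : 0 < ε) :
    ∀ᶠ N : ℕ in atTop, ∃ (M : ℕ) (enc : Fin M → Fin N → 𝓧) (dec : (Fin N → 𝓞) → Fin M),
      Real.exp (N * r) ≤ M ∧ Measurable dec ∧ (∀ j, ∑ t, ρ (enc j t) ≤ N * ∫ x, ρ x ∂P) ∧
      ∀ j, (Measure.pi fun t => μ.map (out (enc j t))) {o | dec o ≠ j} ≤ ε := by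
  -- The decoding threshold `c` per use: below the mean, so the true codeword passes by the law of
  -- large numbers; above `r`, so about `exp (N r)` wrong ones fail.
  obtain ⟨c, hrc, hcI⟩ := exists_between hr
  obtain ⟨κ, hκ, hκN⟩ := exists_le_pi_sum_le_mean P hρ hρ2
  have hιw : Measurable fun w : 𝓧 × Ω => ι w.1 (out w.1 w.2) :=
    hι.comp (measurable_fst.prodMk hout)
  have hlln := tendsto_pi_sum_le (P.prod μ) hιw hint hcI
  have hexp : Tendsto (fun N : ℕ => ENNReal.ofReal (2 * Real.exp (-(N * (c - r))))) atTop
      (𝓝 0) := by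
    have h1 : Tendsto (fun N : ℕ => (N : ℝ) * (c - r)) atTop atTop :=
      tendsto_natCast_atTop_atTop.atTop_mul_const (sub_pos.mpr hrc)
    have h2 := (Real.tendsto_exp_neg_atTop_nhds_zero.comp h1).const_mul 2
    rw [mul_zero] at h2
    simpa using ENNReal.tendsto_ofReal h2
  have hsum := hexp.add hlln
  rw [add_zero] at hsum
  filter_upwards [hκN, hsum.eventually (gt_mem_nhds (ENNReal.mul_pos hε.ne' hκ.ne'))]
    with N hN1 hN2
  set M := ⌈Real.exp (N * r)⌉₊ with hM
  have hM0 : 0 < M := Nat.ceil_pos.mpr (Real.exp_pos _)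
  -- The factor 2 absorbs the rounding, since `r ≥ 0` gives `exp (N r) ≥ 1`.
  have hMle : (M : ℝ) ≤ 2 * Real.exp (N * r) := by
    have h1 := (Nat.ceil_lt_add_one (Real.exp_pos (N * r)).le).le
    have h2 : 1 ≤ Real.exp (N * r) := Real.one_le_exp (by positivity)
    linarith
  let outN : (Fin N → 𝓧) → (Fin N → Ω) → (Fin N → 𝓞) := fun x ω t => out (x t) (ω t)
  have houtN : Measurable fun p : (Fin N → 𝓧) × (Fin N → Ω) => outN p.1 p.2 :=
    measurable_pi_lambda _ fun t => hout.comp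
      (f := fun p : (Fin N → 𝓧) × (Fin N → Ω) => (p.1 t, p.2 t)) (by fun_prop)
  let B : (Fin N → 𝓧) → Set (Fin N → 𝓞) := fun x => {o | N * c < ∑ t, ι (x t) (o t)}
  have hB : MeasurableSet {p : (Fin N → 𝓧) × (Fin N → 𝓞) | p.2 ∈ B p.1} :=
    measurableSet_lt measurable_const (Finset.measurable_fun_sum _ fun t _ =>
      hι.comp (f := fun p : (Fin N → 𝓧) × (Fin N → 𝓞) => (p.1 t, p.2 t)) (by fun_prop))
  have hBx : ∀ x, MeasurableSet (B x) := fun x =>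
    hB.preimage (f := fun o => (x, o)) (by fun_prop)
  -- Markov's inequality for the product of the exponentials: the output does not depend on `x`, and
  -- by `hι1` each independent factor has mean at most 1.
  have hβ : ∀ x, ((Measure.pi fun _ : Fin N => P).prod (Measure.pi fun _ : Fin N => μ))
      {p | outN p.1 p.2 ∈ B x} ≤ ENNReal.ofReal (Real.exp (-(N * c))) := by
    intro x
    rw [prod_pi_apply P μ (s := {p | outN p.1 p.2 ∈ B x}) ((hBx x).preimage houtN)]
    have hmt : ∀ t, Measurable fun w : 𝓧 × Ω =>
        ENNReal.ofReal (Real.exp (ι (x t) (out w.1 w.2))) := fun t =>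
      ((hι.comp (measurable_const.prodMk hout)).exp).ennreal_ofReal
    have h1 : ∫⁻ w, ∏ t, ENNReal.ofReal (Real.exp (ι (x t) (out (w t).1 (w t).2)))
        ∂(Measure.pi fun _ : Fin N => P.prod μ) ≤ 1 := by
      rw [lintegral_pi_prod_eq (fun _ : Fin N => P.prod μ)
        (fun t w => ENNReal.ofReal (Real.exp (ι (x t) (out w.1 w.2)))) hmt]
      exact Finset.prod_le_one' fun t _ => hι1 (x t)
    have h2 := mul_meas_ge_le_lintegral₀ (μ := Measure.pi fun _ : Fin N => P.prod μ)
      (f := fun w => ∏ t, ENNReal.ofReal (Real.exp (ι (x t) (out (w t).1 (w t).2))))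
      (Finset.measurable_fun_prod _ fun t _ =>
        (hmt t).comp (measurable_pi_apply t)).aemeasurable (ENNReal.ofReal (Real.exp (N * c)))
    have h3 := h2.trans h1
    rw [Real.exp_neg, ENNReal.ofReal_inv_of_pos (Real.exp_pos _), ← one_div,
      ENNReal.le_div_iff_mul_le (Or.inl (ENNReal.ofReal_pos.mpr (Real.exp_pos _)).ne')
        (Or.inl ENNReal.ofReal_ne_top), mul_comm]
    refine le_trans ?_ h3
    gcongr
    rename_i w
    intro hw
    rw [← ENNReal.ofReal_prod_of_nonneg fun t _ => (Real.exp_pos _).le, ← Real.exp_sum]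
    exact ENNReal.ofReal_le_ofReal (Real.exp_le_exp.mpr (le_of_lt hw))
  have hmiss : ((Measure.pi fun _ : Fin N => P).prod (Measure.pi fun _ : Fin N => μ))
      {p | outN p.1 p.2 ∉ B p.1} =
      (Measure.pi fun _ : Fin N => P.prod μ) {w | ∑ t, ι (w t).1 (out (w t).1 (w t).2) ≤ N * c} := by
    rw [prod_pi_apply P μ (s := {p | outN p.1 p.2 ∉ B p.1}) (hB.preimage
      (f := fun p : (Fin N → 𝓧) × (Fin N → Ω) => (p.1, outN p.1 p.2)) (by fun_prop)).compl]
    congr 1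
    ext w
    simp [B, outN]
  have hMβ : (M : ℝ≥0∞) * ENNReal.ofReal (Real.exp (-(N * c))) ≤
      ENNReal.ofReal (2 * Real.exp (-(N * (c - r)))) := by
    rw [← ENNReal.ofReal_natCast, ← ENNReal.ofReal_mul (by positivity)]
    refine ENNReal.ofReal_le_ofReal ?_
    calc (M : ℝ) * Real.exp (-(N * c)) ≤ 2 * Real.exp (N * r) * Real.exp (-(N * c)) := by gcongr
      _ = _ := by rw [mul_assoc, ← Real.exp_add]; congr 2; ring
  obtain ⟨x, hx⟩ := exists_codewords (Measure.pi fun _ : Fin N => P) (Measure.pi fun _ : Fin N => μ)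
    houtN hB {w | ∑ t, ρ (w t) ≤ N * ∫ x, ρ x ∂P} _ ε hβ M (by
      rw [hmiss]
      calc _ ≤ ENNReal.ofReal (2 * Real.exp (-(N * (c - r)))) + _ := by gcongr
        _ < ε * κ := hN2
        _ ≤ _ := by gcongr)
  obtain ⟨dec, hdec, hdec2⟩ := exists_decoder (fun k => B (x k)) (fun k => hBx (x k)) hM0
  refine ⟨M, fun j => x j, dec, Nat.le_ceil _, hdec, fun j => (hx j j.isLt).1, fun j => ?_⟩
  refine le_trans ?_ (hx j j.isLt).2
  have hxt : ∀ t, Measurable (out (x j t)) := fun t =>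
    hout.comp (f := fun ω => (x j t, ω)) (by fun_prop)
  have hpm : ∀ t, IsProbabilityMeasure (μ.map (out (x j t))) := fun t =>
    Measure.isProbabilityMeasure_map (hxt t).aemeasurable
  rw [← Measure.pi_map_pi (μ := fun _ : Fin N => μ) (f := fun t => out (x j t))
    fun t => (hxt t).aemeasurable, Measure.map_apply (s := {o | dec o ≠ j})
      (measurable_pi_lambda (fun (ω : Fin N → Ω) t => out (x j t) (ω t)) fun t =>
        (hxt t).comp (measurable_pi_apply t)) (hdec (measurableSet_singleton j)).compl]
  refine measure_mono fun ω hω => ?_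
  simp only [Set.mem_preimage, Set.mem_ofPred_eq] at hω ⊢
  exact fun hc => hω (hdec2 j _ hc.1 hc.2)

end CodingTheorem

end SparseCoding

namespace SparseCoding

/-! ### Reliable communication over the sparse channel -/

variable {n : ℕ} (σ : ℝ≥0) (f : ℝ → ℝ) (α : Measure (Fin n → Bool)) (ν : Measure ℝ)

/-- A single message, sent as the zero word, cannot be decoded wrongly. -/
theorem reliableAt_of_nonpos {R : ℝ} (hR : R ≤ 0) : ReliableAt n σ f α ν R := by
  refine fun ε _ => Eventually.of_forall fun N => ⟨1, ⟨fun _ _ _ => 0, fun _ => 0, fun _ => ?_,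
    measurable_const⟩, ?_, fun m => ?_⟩
  · simp only [ne_eq, OfNat.ofNat_ne_zero, not_false_eq_true, zero_pow, Finset.sum_const_zero]
    positivity
  · rw [Nat.cast_one]
    exact Real.exp_le_one_iff.mpr (mul_nonpos_of_nonneg_of_nonpos (by positivity) hR)
  · simp [Code.errorProb, Subsingleton.elim m 0]

variable [IsProbabilityMeasure α] [IsProbabilityMeasure ν]

theorem memLp_sq_gaussianReal (v : ℝ≥0) : MemLp (fun x : ℝ => x ^ 2) 2 (gaussianReal 0 v) := by
  rw [memLp_two_iff_integrable_sq (by fun_prop)]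
  have h := (memLp_id_gaussianReal (μ := 0) (v := v) 4).integrable_norm_pow (p := 4) (by norm_num)
  refine h.congr (ae_of_all _ fun x => ?_)
  simp only [id, Real.norm_eq_abs]
  rw [← pow_mul, show 2 * 2 = 4 from rfl, Even.pow_abs (by decide)]

theorem memLp_power (n : ℕ) : MemLp (fun u : Fin n → ℝ => ∑ i, u i ^ 2) 2 (inputLaw σ n) :=
  memLp_finsetSum _ fun i _ => (memLp_sq_gaussianReal (σ ^ 2)).comp_measurePreserving
    (measurePreserving_eval (fun _ : Fin n => gaussianReal 0 (σ ^ 2)) i)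

theorem integral_power (n : ℕ) : ∫ u, ∑ i, u i ^ 2 ∂inputLaw σ n = n * (σ : ℝ) ^ 2 := by
  have h1 : ∫ x, x ^ 2 ∂gaussianReal 0 (σ ^ 2) = (σ : ℝ) ^ 2 := by
    have h := variance_of_integral_eq_zero (X := fun x : ℝ => x) (μ := gaussianReal 0 (σ ^ 2))
      (by fun_prop) integral_id_gaussianReal
    rw [variance_fun_id_gaussianReal] at h
    simpa using h.symm
  have hmp := fun i => measurePreserving_eval (fun _ : Fin n => gaussianReal 0 (σ ^ 2)) i
  have hi : ∀ i : Fin n, Integrable (fun u : Fin n → ℝ => u i ^ 2) (inputLaw σ n) := fun i =>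
    ((memLp_sq_gaussianReal (σ ^ 2)).comp_measurePreserving (hmp i)).integrable one_le_two
  rw [integral_finsetSum _ fun i _ => hi i]
  have h2 : ∀ i : Fin n, ∫ u, u i ^ 2 ∂inputLaw σ n = (σ : ℝ) ^ 2 := by
    intro i
    rw [← h1, ← (hmp i).map_eq, integral_map (hmp i).measurable.aemeasurable (by fun_prop)]
  simp [h2]

/-- Rates below `I(U; Y | A, H)` are achieved over the channel of dimension `n`. -/
theorem reliableAt_of_lt
    (hν : 0 < n → MemLp id 2 ν ∧ ∫ x, x ∂ν = 0 ∧ variance id ν = 1 / (n : ℝ)) {R : ℝ}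
    (hR : 0 ≤ R) (h : n * R < ∫ ω, modelInfoU σ f ω ∂modelLaw σ f α ν) :
    ReliableAt n σ f α ν R := by
  intro ε hε
  have hD := hasChannelDensity_densityU σ f α ν
  let out : (Fin n → ℝ) → State n → Output n := fun u z => (received u z, z.2.1, z.2.2.1)
  let ι : (Fin n → ℝ) → Output n → ℝ := fun u o =>
    infoDensity (densityU f) (inputLaw σ n) (o.2.1, o.2.2) u o.1
  have hout : Measurable fun p : (Fin n → ℝ) × State n => out p.1 p.2 :=
    (measurable_received n).prodMk (by fun_prop)
  have hι : Measurable fun p : (Fin n → ℝ) × Output n => ι p.1 p.2 :=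
    hD.measurable_infoDensity.comp (f := fun p : (Fin n → ℝ) × Output n =>
      ((p.2.2.1, p.2.2.2), p.1, p.2.1)) (by fun_prop)
  -- For fixed `u`, the exponential of the information density times the output density is
  -- `densityU` at `u`, of integral 1.
  have hι1 : ∀ u, ∫⁻ w, ENNReal.ofReal (Real.exp (ι u (out w.1 w.2)))
      ∂((inputLaw σ n).prod (stateLaw f α ν)) ≤ 1 := by
    intro u
    have hm : Measurable fun t : SideInfo n × (Fin n → ℝ) => ENNReal.ofReal (Real.exp
        (infoDensity (densityU f) (inputLaw σ n) t.1 u t.2)) :=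
      (hD.measurable_infoDensity.comp (f := fun t : SideInfo n × (Fin n → ℝ) => (t.1, u, t.2))
        (by fun_prop)).exp.ennreal_ofReal
    refine (hD.lintegral_comp_out _ hm).trans_le (le_of_eq ?_)
    have : ∀ z y, ENNReal.ofReal (outDensity (densityU f) (inputLaw σ n) z y) *
        ENNReal.ofReal (Real.exp (infoDensity (densityU f) (inputLaw σ n) z u y)) =
        ENNReal.ofReal (densityU f z u y) := by
      intro z y
      rw [infoDensity, Real.exp_log (hD.ratio_pos z u y),
        ← ENNReal.ofReal_mul (hD.outDensity_pos z y).le, mul_div_cancel₀ _ (hD.outDensity_pos z y).ne']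
    simp only [this, lintegral_densityU, lintegral_const, measure_univ, mul_one]
  have hcode := eventually_exists_code (inputLaw σ n) (stateLaw f α ν) hout hι hι1
    (integrable_modelInfoU σ f α ν hν) (ρ := fun u => ∑ i, u i ^ 2) (by fun_prop)
    (memLp_power σ n) (r := n * R) (by positivity) h hε
  filter_upwards [hcode] with N hN
  obtain ⟨M, enc, dec, hM, hdec, hpow, herr⟩ := hN
  refine ⟨M, ⟨enc, dec, fun j => ?_, hdec⟩, ?_, herr⟩
  · have := hpow j
    rw [integral_power, ← mul_assoc] at this
    exact this
  · rw [mul_assoc]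
    exact hM

theorem infoX_div_le
    (hν : 0 < n → MemLp id 2 ν ∧ ∫ x, x ∂ν = 0 ∧ variance id ν = 1 / (n : ℝ)) :
    infoX σ f α ν / (n : ℝ≥0∞) ≤ ENNReal.ofReal ((σ : ℝ) ^ 2 + 1) := by
  refine ENNReal.div_le_of_le_mul ((infoX_le σ f α ν hν).trans (le_of_eq ?_))
  rw [mul_comm, ENNReal.ofReal_mul (by positivity), ENNReal.ofReal_natCast]

/-- If `I(X; Y | A, H) / n` exceeds `R` by more than the entropy rate of the pattern, then `R` is
achieved in dimension `n`. -/
theorem reliableAt_of_lt_infoX_div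
    (hν : 0 < n → MemLp id 2 ν ∧ ∫ x, x ∂ν = 0 ∧ variance id ν = 1 / (n : ℝ)) (hn : 0 < n)
    {R η : ℝ} (hR : 0 < R) (hη : 0 ≤ η) (hS : entropy (patternPMF f n) ≤ n * η)
    (h : ENNReal.ofReal (R + η) < infoX σ f α ν / (n : ℝ≥0∞)) : ReliableAt n σ f α ν R := by
  have hn' : (0 : ℝ) < n := by exact_mod_cast hn
  refine reliableAt_of_lt σ f α ν hν hR.le ?_
  have h1 : ENNReal.ofReal (n * (R + η)) < infoX σ f α ν := by
    rw [mul_comm, ENNReal.ofReal_mul (by positivity), ENNReal.ofReal_natCast]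
    exact ENNReal.mul_lt_of_lt_div h
  set J := ∫ ω, modelInfoU σ f ω ∂modelLaw σ f α ν with hJ
  have h2 := h1.trans_le (infoX_le_infoU_add σ f α ν hν)
  rw [infoU_eq σ f α ν hν, ← hJ] at h2
  by_contra hcon
  push Not at hcon
  refine absurd h2 (not_lt.mpr ?_)
  calc ENNReal.ofReal J + ENNReal.ofReal (entropy (patternPMF f n)) ≤
      ENNReal.ofReal (n * R) + ENNReal.ofReal (n * η) := by gcongr
    _ = ENNReal.ofReal (n * (R + η)) := by
      rw [← ENNReal.ofReal_add (by positivity) (by positivity), mul_add]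

end SparseCoding

end

/-! ### The main theorem -/

theorem mainTheorem5 (σ : ℝ≥0) (q : unitInterval) (f : ℝ → ℝ)
    (hf : ContinuousOn f (Set.Icc 0 1))
    (m_a : ℝ) (hm_a : m_a ∈ Set.Icc (0 : ℝ) 1)
    (hmax : ∀ m ∈ Set.Icc (0 : ℝ) 1, m ≠ m_a →
      Real.binEntropy m + f m < Real.binEntropy m_a + f m_a)
    (α : (n : ℕ) → Measure (Fin n → Bool)) [∀ n, IsProbabilityMeasure (α n)]
    (hα : SparseCoding.HasSamplingRate q α)
    (ν : ℕ → Measure ℝ) [∀ n, IsProbabilityMeasure (ν n)]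
    (hν : ∀ n, 0 < n → MemLp id 2 (ν n) ∧ ∫ x, x ∂(ν n) = 0 ∧
      variance id (ν n) = 1 / (n : ℝ)) :
    (∀ n, SparseCoding.infoX σ f (α n) (ν n) ≤ SparseCoding.infoU σ f (α n) (ν n) +
      ENNReal.ofReal (SparseCoding.entropy (SparseCoding.patternPMF f n))) ∧
    SparseCoding.rateI1 σ f α ν ≠ ∞ ∧
    SparseCoding.IsAchievableRate σ f α ν
      ((SparseCoding.rateI1 σ f α ν).toReal - Real.binEntropy m_a) ∧
    (Tendsto (fun n : ℕ => SparseCoding.infoX σ f (α n) (ν n) / (n : ℝ≥0∞)) atTop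
        (𝓝 (SparseCoding.rateI1 σ f α ν)) →
      ∀ R' < (SparseCoding.rateI1 σ f α ν).toReal - Real.binEntropy m_a,
        ∀ᶠ n in atTop, SparseCoding.ReliableAt n σ f (α n) (ν n) R') := by
  have hH : 0 ≤ Real.binEntropy m_a := Real.binEntropy_nonneg hm_a.1 hm_a.2
  have hfin : SparseCoding.rateI1 σ f α ν ≠ ∞ := by
    refine ne_top_of_le_ne_top (ENNReal.ofReal_ne_top (r := (σ : ℝ) ^ 2 + 1)) ?_
    refine limsup_le_of_le (by isBoundedDefault) ?_
    exact Eventually.of_forall fun n => SparseCoding.infoX_div_le σ f (α n) (ν n) (hν n)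
  have key : ∀ R' < (SparseCoding.rateI1 σ f α ν).toReal - Real.binEntropy m_a, 0 < R' →
      ∃ t : ℝ≥0∞, t < SparseCoding.rateI1 σ f α ν ∧ ∀ᶠ n : ℕ in atTop,
        t < SparseCoding.infoX σ f (α n) (ν n) / (n : ℝ≥0∞) →
        SparseCoding.ReliableAt n σ f (α n) (ν n) R' := by
    intro R' hR' hpos
    -- Half of the slack pays for the excess of the entropy rate over `H₂(m_a)`; the other half
    -- keeps the threshold strictly below `𝓘₁`. Information rates then exceed it infinitely often,
    -- or eventually if they converge.
    set δ := ((SparseCoding.rateI1 σ f α ν).toReal - Real.binEntropy m_a - R') / 2 with hδ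
    have hδ0 : 0 < δ := by linarith
    refine ⟨ENNReal.ofReal (R' + (Real.binEntropy m_a + δ)), ?_, ?_⟩
    · rw [ENNReal.ofReal_lt_iff_lt_toReal (by positivity) hfin]
      linarith
    · filter_upwards [SparseCoding.eventually_entropy_patternPMF_le hf hm_a hmax hδ0,
        eventually_gt_atTop 0] with n hn hn0 hlt
      exact SparseCoding.reliableAt_of_lt_infoX_div σ f (α n) (ν n) (hν n) hn0 hpos
        (by positivity) hn hlt
  refine ⟨fun n => SparseCoding.infoX_le_infoU_add σ f (α n) (ν n) (hν n), hfin, ?_, ?_⟩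
  · intro R' hR'
    rcases le_or_gt R' 0 with h0 | h0
    · exact Frequently.of_forall fun n => SparseCoding.reliableAt_of_nonpos σ f (α n) (ν n) h0
    · obtain ⟨t, ht, hev⟩ := key R' hR' h0
      exact (frequently_lt_of_lt_limsup (by isBoundedDefault) ht).mp (hev.mono fun _ h => h)
  · intro hlim R' hR'
    rcases le_or_gt R' 0 with h0 | h0
    · exact Eventually.of_forall fun n => SparseCoding.reliableAt_of_nonpos σ f (α n) (ν n) h0
    · obtain ⟨t, ht, hev⟩ := key R' hR' h0
      filter_upwards [hev, hlim.eventually (lt_mem_nhds ht)] with n h1 h2 using h1 h2
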